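/- Let $n\ge 1$ workers and a budget of $B\ge 1$ tasks per round be given, and let $\mathcal A=\{\bm a\in\mathbb N^n:\sum_i a_i=B\}$. In round $k=1,2,\dots$ worker $i$ needs time $X_{i,k}^{(u)}$ for its $u$-th task; for each $i$ the times $X_{i,k}^{(u)}$ ($u\ge 1$) are i.i.d. copies of an almost surely positive random variable $X_i$ with mean $\mu_i$. The tables $(X_{i,k}^{(u)})_{i,u}$ of the different rounds $k$ are independent and identically distributed; no assumption is made on the joint law of different workers within a round (in particular they may be independent). For $\bm a\in\mathcal A$ let $C(\bm a)=\max_{i:\,a_i\ge 1}\sum_{u=1}^{a_i}X_{i,k}^{(u)}$ be the computation time of round $k$ with allocation $\bm a$; its expectation $\mathbb E[C(\bm a)]$ does not depend on $k$. Put $\|Y\|_{\psi_1}=\inf\{c>0:\mathbb E\,e^{|Y|/c}\le 2\}$, assume that $\alpha_i:=\|X_i-\mu_i\|_{\psi_1}\le\alpha$ for all $i$, where $\alpha\ge 0$, and let $\eta=\max_i\alpha_i/\mu_i$. The algorithm ATA with inputs $(B,\alpha)$ plays in round $k$ an allocation $\bm a_k\in\operatorname{argmin}_{\bm a\in\mathcal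 A}\max_i a_i s_{i,k}$ (ties broken arbitrarily, using only information available before round $k$, which is independent of the computation times of round $k$). Here $K_{i,k}$ is the number of tasks done by worker $i$ before round $k$ and $\hat\mu_{i,k}$ is the mean of their observed times; $s_{i,k}=0$ if $K_{i,k}=0$, and otherwise $$s_{i,k}=\max\Big\{0,\ \hat\mu_{i,k}-2\alpha\Big(\sqrt{\tfrac{\ln(2k^2)}{K_{i,k}}}+\tfrac{\ln(2k^2)}{K_{i,k}}\Big)\Big\}.$$ Let $\mathcal C_K=\sum_{k=1}^K\mathbb E[C(\bm a_k)]$ and $\mathcal C_K^*=K\min_{\bm a\in\mathcal A}\mathbb E[C(\bm a)]$. Then every $C(\bm a_k)$ is integrable, and there is a constant $c$ depending only on $n$, $B$, $\alpha$ and $(\mu_1,\dots,\mu_n)$ such that for all $K\ge 2$ $$\mathcal C_K\le (1+4\eta\ln B)\,\mathcal C_K^*+c\ln K .$$ -/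

import Mathlib

open MeasureTheory ProbabilityTheory
open scoped ENNReal

namespace ATA

noncomputable section

/-- The sub-exponential (Orlicz `ψ₁`) norm `inf {C > 0 : 𝔼 exp(|Y| / C) ≤ 2}` of a real random
variable `Y`; it is `∞` when there is no such `C`. -/
def psi1Norm {S : Type*} [MeasurableSpace S] (P : Measure S) (Y : S → ℝ) : ℝ≥0∞ :=
  ⨅ (C : ℝ) (_ : 0 < C) (_ : ∫⁻ x, ENNReal.ofReal (Real.exp (|Y x| / C)) ∂P ≤ 2),
    ENNReal.ofReal C

/-- The allocations of `B` tasks to `n` workers. -/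
def allocations (n B : ℕ) : Set (Fin n → ℕ) := {a | ∑ i, a i = B}

/-- `a` minimizes `f` over the allocations of `B` tasks. -/
def IsBestAllocation {n : ℕ} (B : ℕ) (f : (Fin n → ℕ) → ℝ) (a : Fin n → ℕ) : Prop :=
  a ∈ allocations n B ∧ ∀ b ∈ allocations n B, f a ≤ f b

/-- The proxy loss `ℓ(a, s) = max_i a_i s_i`. -/
def proxyLoss {n : ℕ} (a : Fin n → ℕ) (s : Fin n → ℝ) : ℝ := ⨆ i, (a i : ℝ) * s i

/-- The computation time `C(a) = max_{i ∈ supp a} ∑_{u=1}^{a_i} x_i^{(u)}` of one round with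
allocation `a`, where `x i u` is the time that worker `i` takes for its task number `u`
(tasks are numbered from `0`). -/
def compTime {n : ℕ} (a : Fin n → ℕ) (x : Fin n → ℕ → ℝ) : ℝ :=
  ⨆ i : {i : Fin n // a i ≠ 0}, ∑ u ∈ Finset.range (a i), x i u

/-- `ρ` is a possible joint law of the computation times `(x i u)` of one round: for each worker
`i`, the times `x i 0, x i 1, …` are i.i.d. with law `ν i`. Nothing is required about the joint
law of different workers; they may in particular be independent. -/
structure IsRoundLaw {n : ℕ} (ν : Fin n → Measure ℝ) (ρ : Measure (Fin n → ℕ → ℝ)) : Prop where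
  law : ∀ i u, ρ.map (fun x => x i u) = ν i
  indep : ∀ i, iIndepFun (fun (u : ℕ) (x : Fin n → ℕ → ℝ) => x i u) ρ

/-- The computation times `X k i u` (round `k`, worker `i`, task `u`) are drawn afresh in each
round from `ρ`: `ℱ k` is the information available before round `k`, the times of round `k` have
joint law `ρ`, are independent of `ℱ k`, and belong to `ℱ (k + 1)`. Rounds are numbered
from `0`. -/
structure IsTimes {n : ℕ} {Ω : Type*} [mΩ : MeasurableSpace Ω] (P : Measure Ω)
    (ℱ : Filtration ℕ mΩ) (ρ : Measure (Fin n → ℕ → ℝ))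
    (X : ℕ → Ω → Fin n → ℕ → ℝ) : Prop where
  measurable : ∀ k, Measurable[ℱ (k + 1)] (X k)
  law : ∀ k, P.map (X k) = ρ
  indep : ∀ k, Indep (MeasurableSpace.comap (X k) inferInstance) (ℱ k) P

/-- Number of tasks done by worker `i` before round `k`, given the allocations `a` of the
rounds. -/
def count {n : ℕ} (a : ℕ → Fin n → ℕ) (k : ℕ) (i : Fin n) : ℕ :=
  ∑ q ∈ Finset.range k, a q i

/-- Total time used by worker `i` before round `k`, given the allocations `a` and the
computation times `x` of the rounds. -/
def usageTime {n : ℕ} (a : ℕ → Fin n → ℕ) (x : ℕ → Fin n → ℕ → ℝ) (k : ℕ) (i : Fin n) : ℝ :=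
  ∑ q ∈ Finset.range k, ∑ u ∈ Finset.range (a q i), x q i u

/-- Empirical mean time of worker `i` before round `k` (`0` if it has done no task yet). -/
def empMean {n : ℕ} (a : ℕ → Fin n → ℕ) (x : ℕ → Fin n → ℕ → ℝ) (k : ℕ) (i : Fin n) : ℝ :=
  usageTime a x k i / count a k i

/-- Width of the confidence interval after `m ≥ 1` samples, in the round numbered `k` from `0`,
that is in the round number `k + 1` when rounds are numbered from `1`. -/
def conf (α : ℝ) (k m : ℕ) : ℝ :=
  2 * α * (Real.sqrt (Real.log (2 * ((k : ℝ) + 1) ^ 2) / m)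
    + Real.log (2 * ((k : ℝ) + 1) ^ 2) / m)

/-- The lower confidence bound `(empirical mean - conf)₊` used in round `k`. The width is `+∞`
without samples, and the bound is then `0`. -/
def lcb {n : ℕ} (α : ℝ) (a : ℕ → Fin n → ℕ) (x : ℕ → Fin n → ℕ → ℝ) (k : ℕ) (i : Fin n) : ℝ :=
  if count a k i = 0 then 0 else max (empMean a x k i - conf α k (count a k i)) 0

/-- `a k` is the (random) allocation played in round `k` by the algorithm ATA with inputs
`(B, α)`: it is determined by the information available before round `k`, and it minimizes the
proxy loss at the current lower confidence bounds. Ties may be broken in any such way. -/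
structure IsATA {n : ℕ} {Ω : Type*} [mΩ : MeasurableSpace Ω] (B : ℕ) (α : ℝ)
    (ℱ : Filtration ℕ mΩ) (X : ℕ → Ω → Fin n → ℕ → ℝ) (a : ℕ → Ω → Fin n → ℕ) : Prop where
  measurable : ∀ k, Measurable[ℱ k] (a k)
  argmin : ∀ k ω, IsBestAllocation B
    (fun b => proxyLoss b (lcb α (fun q => a q ω) (fun q => X q ω) k)) (a k ω)

/-- `𝔼[C(a)]`, the expected computation time of a round with the fixed allocation `a`. -/
def meanTime {n : ℕ} (ρ : Measure (Fin n → ℕ → ℝ)) (a : Fin n → ℕ) : ℝ :=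
  ∫ x, compTime a x ∂ρ

/-- The expected total computation time `∑_k 𝔼[C(a_k)]` of the first `K` rounds. -/
def totalTime {n : ℕ} {Ω : Type*} [MeasurableSpace Ω] (P : Measure Ω)
    (X : ℕ → Ω → Fin n → ℕ → ℝ) (a : ℕ → Ω → Fin n → ℕ) (K : ℕ) : ℝ :=
  ∑ k ∈ Finset.range K, ∫ ω, compTime (a k ω) (X k ω) ∂P

/-- `η = max_i ‖X_i - μ_i‖_{ψ₁} / μ_i` for workers with time distributions `ν i` and
means `μ i`. -/
def eta {n : ℕ} (ν : Fin n → Measure ℝ) (μ : Fin n → ℝ) : ℝ :=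
  ⨆ i, (psi1Norm (ν i) (fun x => x - μ i)).toReal / μ i

end

end ATA

/-!
Call an allocation optimal for the proxy loss if it minimizes `max_i a_i μ_i`, with minimum `l`. Two
facts about a single round compare the proxy loss with the expected computation time. The maximum of
the expectations is at most the expectation of the maximum (`IsRoundLaw.proxyLoss_le_meanTime`), and
conversely the sub-exponential maximal inequality loses at most the factor `1 + 4 η log B`
(`IsRoundLaw.meanTime_le`), because at most `B` workers are active and the deviation of each total
time from its mean has `ψ₁` norm at most `η` times the proxy loss. Hence each round with an optimal
allocation costs at most `1 + 4 η log B` times the optimal expected time, and it remains to see that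
the expected number of suboptimal rounds is `O(log K)`; each of them costs at most the constant
`B ∑ μ_i`.

Since the times of a round are independent of the past, the exponential of the compensated total
time of a worker is a supermartingale (`lintegral_exp_usageTime_le_one`). Fixing the number of
samples before choosing the exponent gives Bernstein's inequality without relabelling the samples,
and a union bound over the at most `B k` sample sizes shows that some confidence interval of the
`k`-th round is incorrect with probability at most `n B / k` (`measure_badEvent_le`); the sum over
`k` is logarithmic.

If all confidence intervals are correct, the lower confidence bounds are at most the means, so the
proxy loss that ATA minimizes has minimum at most `l`. A suboptimal choice therefore underestimates
one of the workers that it uses by a fixed amount, as only finitely many values `j μ_i` with `j ≤ B`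
compete with `l`, and this worker has done only `O(log K)` tasks (`exists_count_mul_sq_le`). Each
such round gives it another task, so there are `O(log K)` of them (`card_filter_count_le`).
-/

namespace ATA

/-! ### Sub-exponential random variables -/

/-- Termwise comparison of the exponential series: if `|x| ≤ t z` with `0 ≤ t ≤ 1`, all terms of
degree at least two gain a factor `t ^ 2`. -/
theorem exp_le_of_abs_eq_mul {x t z : ℝ} (ht : 0 ≤ t) (ht1 : t ≤ 1) (hz : 0 ≤ z)
    (hx : |x| = t * z) : Real.exp x ≤ 1 + x + t ^ 2 * (Real.exp z - 1) := by
  have key : ∀ y : ℝ, HasSum (fun k : ℕ => y ^ (k + 2) / (k + 2).factorial)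
      (Real.exp y - (1 + y)) := by
    intro y
    have h := NormedSpace.expSeries_div_hasSum_exp (𝔸 := ℝ) y
    rw [← Real.exp_eq_exp_ℝ] at h
    have h2 := (hasSum_nat_add_iff' 2).2 h
    simpa [Finset.sum_range_succ] using h2
  have h := hasSum_le (fun k => ?_) (key x) ((key z).mul_left (t ^ 2))
  · nlinarith [sq_nonneg t]
  · have h1 : x ^ (k + 2) ≤ t ^ 2 * z ^ (k + 2) := by
      calc x ^ (k + 2) ≤ |x ^ (k + 2)| := le_abs_self _
        _ = t ^ (k + 2) * z ^ (k + 2) := by rw [abs_pow, hx, mul_pow]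
        _ ≤ t ^ 2 * z ^ (k + 2) := by
          gcongr ?_ * _
          exact pow_le_pow_of_le_one ht ht1 (by omega)
    rw [← mul_div_assoc]
    gcongr

section Orlicz

variable {S : Type*} [MeasurableSpace S] {P : Measure S} {Y : S → ℝ}

theorem lintegral_exp_le_two_of_psi1Norm_lt {c : ℝ} (h : psi1Norm P Y < ENNReal.ofReal c) :
    ∫⁻ x, ENNReal.ofReal (Real.exp (|Y x| / c)) ∂P ≤ 2 := by
  simp only [psi1Norm, iInf_lt_iff] at h
  obtain ⟨C, hC, hC2, hCc⟩ := h
  have hCc' : C < c := (ENNReal.ofReal_lt_ofReal_iff_of_nonneg hC.le).1 hCc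
  refine (lintegral_mono fun x => ?_).trans hC2
  gcongr

/-- The infimum defining the `ψ₁` norm is attained when it is positive. -/
theorem lintegral_exp_le_two_of_psi1Norm_le {c : ℝ} (hc : 0 < c) (hY : Measurable Y)
    (h : psi1Norm P Y ≤ ENNReal.ofReal c) :
    ∫⁻ x, ENNReal.ofReal (Real.exp (|Y x| / c)) ∂P ≤ 2 := by
  have hlim : Filter.Tendsto (fun k : ℕ => c + 1 / ((k : ℝ) + 1)) Filter.atTop (nhds c) := by
    simpa using (tendsto_one_div_add_atTop_nhds_zero_nat (𝕜 := ℝ)).const_add c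
  have hpt : ∀ x, ENNReal.ofReal (Real.exp (|Y x| / c)) = Filter.liminf
      (fun k : ℕ => ENNReal.ofReal (Real.exp (|Y x| / (c + 1 / ((k : ℝ) + 1))))) Filter.atTop := by
    intro x
    refine (Filter.Tendsto.liminf_eq ?_).symm
    exact (ENNReal.continuous_ofReal.tendsto _).comp
      ((Real.continuous_exp.tendsto _).comp (tendsto_const_nhds.div hlim hc.ne'))
  calc ∫⁻ x, ENNReal.ofReal (Real.exp (|Y x| / c)) ∂P
      = ∫⁻ x, Filter.liminf (fun k : ℕ =>
          ENNReal.ofReal (Real.exp (|Y x| / (c + 1 / ((k : ℝ) + 1))))) Filter.atTop ∂P :=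
        lintegral_congr hpt
    _ ≤ Filter.liminf (fun k : ℕ => ∫⁻ x,
          ENNReal.ofReal (Real.exp (|Y x| / (c + 1 / ((k : ℝ) + 1)))) ∂P) Filter.atTop :=
        lintegral_liminf_le fun k => by fun_prop
    _ ≤ Filter.liminf (fun _ : ℕ => (2 : ℝ≥0∞)) Filter.atTop := by
        refine Filter.liminf_le_liminf (Filter.Eventually.of_forall fun k => ?_)
        refine lintegral_exp_le_two_of_psi1Norm_lt (h.trans_lt ?_)
        have : (0 : ℝ) < 1 / ((k : ℝ) + 1) := by positivity
        exact (ENNReal.ofReal_lt_ofReal_iff (by positivity)).2 (by linarith)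
    _ = 2 := by simp

theorem integrable_exp_of_lintegral_le_two {f : S → ℝ} (hf : Measurable f)
    (h : ∫⁻ x, ENNReal.ofReal (Real.exp (f x)) ∂P ≤ 2) :
    Integrable (fun x => Real.exp (f x)) P := by
  refine ⟨by fun_prop, ?_⟩
  rw [hasFiniteIntegral_iff_ofReal (Filter.Eventually.of_forall fun x => (Real.exp_pos _).le)]
  exact h.trans_lt (by simp)

theorem integral_exp_le_two_of_lintegral_le_two {f : S → ℝ} (hf : Measurable f)
    (h : ∫⁻ x, ENNReal.ofReal (Real.exp (f x)) ∂P ≤ 2) :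
    ∫ x, Real.exp (f x) ∂P ≤ 2 := by
  rw [integral_eq_lintegral_of_nonneg_ae (Filter.Eventually.of_forall fun x => (Real.exp_pos _).le)
    (by fun_prop)]
  exact ENNReal.toReal_le_of_le_ofReal (by norm_num) (by simpa using h)

theorem integrable_of_lintegral_exp_le_two {c : ℝ} (hc : 0 < c) (hY : Measurable Y)
    (h : ∫⁻ x, ENNReal.ofReal (Real.exp (|Y x| / c)) ∂P ≤ 2) : Integrable Y P := by
  refine ((integrable_exp_of_lintegral_le_two (by fun_prop) h).const_mul c).mono'
    hY.aestronglyMeasurable (Filter.Eventually.of_forall fun x => ?_)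
  have := Real.add_one_le_exp (|Y x| / c)
  calc ‖Y x‖ = c * (|Y x| / c) := by rw [Real.norm_eq_abs]; field_simp
    _ ≤ c * Real.exp (|Y x| / c) := by gcongr; linarith

theorem lintegral_exp_mul_le_of_lintegral_exp_le_two [IsProbabilityMeasure P] {c θ : ℝ}
    (hc : 0 < c) (hY : Measurable Y)
    (hmean : ∫ x, Y x ∂P = 0) (h : ∫⁻ x, ENNReal.ofReal (Real.exp (|Y x| / c)) ∂P ≤ 2)
    (hθ : |θ| * c ≤ 1) :
    ∫⁻ x, ENNReal.ofReal (Real.exp (θ * Y x)) ∂P ≤ ENNReal.ofReal (Real.exp (θ ^ 2 * c ^ 2)) := by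
  have hI := integrable_of_lintegral_exp_le_two hc hY h
  have hE := integrable_exp_of_lintegral_le_two (by fun_prop) h
  have hpt : ∀ x, Real.exp (θ * Y x) ≤
      1 + θ * Y x + (|θ| * c) ^ 2 * (Real.exp (|Y x| / c) - 1) := fun x =>
    exp_le_of_abs_eq_mul (by positivity) hθ (by positivity) (by rw [abs_mul]; field_simp)
  have hI1 : Integrable (fun x => 1 + θ * Y x) P := (integrable_const _).add (hI.const_mul _)
  have hI2 : Integrable (fun x => (|θ| * c) ^ 2 * (Real.exp (|Y x| / c) - 1)) P :=
    (hE.sub (integrable_const _)).const_mul _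
  have hI3 : Integrable (fun x => 1 + θ * Y x +
      (|θ| * c) ^ 2 * (Real.exp (|Y x| / c) - 1)) P := hI1.add hI2
  refine (lintegral_mono fun x => ENNReal.ofReal_le_ofReal (hpt x)).trans ?_
  rw [← ofReal_integral_eq_lintegral_ofReal hI3
    (Filter.Eventually.of_forall fun x => (Real.exp_pos _).le.trans (hpt x))]
  refine ENNReal.ofReal_le_ofReal ?_
  have h2 := integral_exp_le_two_of_lintegral_le_two (by fun_prop) h
  rw [integral_add hI1 hI2, integral_add (integrable_const _) (hI.const_mul _),
    integral_const_mul, integral_const_mul, integral_sub hE (integrable_const _), hmean]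
  have h3 := Real.add_one_le_exp (θ ^ 2 * c ^ 2)
  have h4 : (|θ| * c) ^ 2 = θ ^ 2 * c ^ 2 := by rw [mul_pow, sq_abs]
  simp only [integral_const, measureReal_def, measure_univ, ENNReal.toReal_one, smul_eq_mul]
  rw [h4]
  nlinarith [mul_nonneg (sq_nonneg θ) (sq_nonneg c)]

/-- The quadratic bound on the cumulant generating function of a centered sub-exponential variable;
the width of the confidence intervals is tuned for exactly these constants. The case `c = 0` of an
almost surely constant variable is included. -/
theorem lintegral_exp_mul_le [IsProbabilityMeasure P] {c θ : ℝ} (hc : 0 ≤ c) (hY : Measurable Y)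
    (hmean : ∫ x, Y x ∂P = 0) (h : psi1Norm P Y ≤ ENNReal.ofReal c) (hθ : |θ| * c ≤ 1) :
    ∫⁻ x, ENNReal.ofReal (Real.exp (θ * Y x)) ∂P ≤ ENNReal.ofReal (Real.exp (θ ^ 2 * c ^ 2)) := by
  rcases hc.eq_or_lt with rfl | hc
  · have hlim : Filter.Tendsto (fun t : ℝ => ENNReal.ofReal (Real.exp (θ ^ 2 * t ^ 2)))
        (nhdsWithin 0 (Set.Ioi 0)) (nhds (ENNReal.ofReal (Real.exp (θ ^ 2 * 0 ^ 2)))) := by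
      refine Filter.Tendsto.mono_left ?_ nhdsWithin_le_nhds
      refine (ENNReal.continuous_ofReal.tendsto _).comp (Continuous.tendsto ?_ _)
      fun_prop
    refine ge_of_tendsto hlim ?_
    have hev : ∀ᶠ t : ℝ in nhdsWithin 0 (Set.Ioi 0), |θ| * t < 1 := by
      refine nhdsWithin_le_nhds ?_
      have hc : Continuous fun t : ℝ => |θ| * t := by fun_prop
      exact (hc.tendsto 0).eventually (gt_mem_nhds (by simp))
    filter_upwards [hev, self_mem_nhdsWithin] with t ht1 ht
    exact lintegral_exp_mul_le_of_lintegral_exp_le_two ht hY hmean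
      (lintegral_exp_le_two_of_psi1Norm_le ht hY
        (h.trans (ENNReal.ofReal_le_ofReal (le_of_lt ht)))) ht1.le
  · exact lintegral_exp_mul_le_of_lintegral_exp_le_two hc hY hmean
      (lintegral_exp_le_two_of_psi1Norm_le hc hY h) hθ

end Orlicz

/-! ### The computation time of one round -/

section Pointwise

variable {n B : ℕ} {a : Fin n → ℕ}

theorem exists_ne_zero_of_mem_allocations (hB : 0 < B) (ha : a ∈ allocations n B) :
    ∃ i, a i ≠ 0 := by
  by_contra! h
  have : ∑ i, a i = B := ha
  simp [h] at this
  omega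

theorem le_of_mem_allocations (ha : a ∈ allocations n B) (i : Fin n) : a i ≤ B := by
  have : ∑ i, a i = B := ha
  rw [← this]
  exact Finset.single_le_sum (f := a) (fun _ _ => Nat.zero_le _) (Finset.mem_univ i)

theorem le_proxyLoss (a : Fin n → ℕ) (s : Fin n → ℝ) (i : Fin n) :
    (a i : ℝ) * s i ≤ proxyLoss a s :=
  le_ciSup (f := fun i => (a i : ℝ) * s i) (Set.finite_range _).bddAbove i

theorem sum_le_compTime (x : Fin n → ℕ → ℝ) {i : Fin n} (hi : a i ≠ 0) :
    ∑ u ∈ Finset.range (a i), x i u ≤ compTime a x :=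
  le_ciSup (f := fun i : {i : Fin n // a i ≠ 0} => ∑ u ∈ Finset.range (a i), x i u)
    (Set.finite_range _).bddAbove ⟨i, hi⟩

theorem compTime_le {x : Fin n → ℕ → ℝ} {C : ℝ} (ha : ∃ i, a i ≠ 0)
    (h : ∀ i, a i ≠ 0 → ∑ u ∈ Finset.range (a i), x i u ≤ C) : compTime a x ≤ C := by
  obtain ⟨i, hi⟩ := ha
  have : Nonempty {i : Fin n // a i ≠ 0} := ⟨⟨i, hi⟩⟩
  exact ciSup_le fun i => h i i.2

theorem measurable_compTime (a : Fin n → ℕ) : Measurable (compTime a) := by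
  refine Measurable.iSup fun i => ?_
  fun_prop

theorem abs_compTime_le (ha : ∃ i, a i ≠ 0) (x : Fin n → ℕ → ℝ) :
    |compTime a x| ≤ ∑ i, ∑ u ∈ Finset.range (a i), |x i u| := by
  have hrow : ∀ i, |∑ u ∈ Finset.range (a i), x i u| ≤
      ∑ i, ∑ u ∈ Finset.range (a i), |x i u| := fun i =>
    (Finset.abs_sum_le_sum_abs _ _).trans
      (Finset.single_le_sum (f := fun i => ∑ u ∈ Finset.range (a i), |x i u|)
        (fun _ _ => Finset.sum_nonneg fun _ _ => abs_nonneg _) (Finset.mem_univ i))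
  refine abs_le.2 ⟨?_, compTime_le ha fun i _ => (le_abs_self _).trans (hrow i)⟩
  obtain ⟨i, hi⟩ := ha
  exact (neg_le_neg (hrow i)).trans ((neg_abs_le _).trans (sum_le_compTime x hi))

end Pointwise

section RoundLaw

variable {n B : ℕ} {ν : Fin n → Measure ℝ} {ρ : Measure (Fin n → ℕ → ℝ)} {μ : Fin n → ℝ}
  {a : Fin n → ℕ}

theorem IsRoundLaw.measurePreserving (hρ : IsRoundLaw ν ρ) (i : Fin n) (u : ℕ) :
    MeasurePreserving (fun x : Fin n → ℕ → ℝ => x i u) ρ (ν i) :=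
  ⟨by fun_prop, hρ.law i u⟩

theorem IsRoundLaw.integral_eval (hρ : IsRoundLaw ν ρ) (i : Fin n) (u : ℕ) {f : ℝ → ℝ}
    (hf : AEStronglyMeasurable f (ν i)) : ∫ x, f (x i u) ∂ρ = ∫ y, f y ∂(ν i) := by
  have hm : Measurable fun x : Fin n → ℕ → ℝ => x i u := (hρ.measurePreserving i u).measurable
  rw [← hρ.law i u, integral_map hm.aemeasurable]
  rwa [hρ.law i u]

theorem IsRoundLaw.integrable_eval (hρ : IsRoundLaw ν ρ)
    (hint : ∀ i, Integrable (fun y => y) (ν i)) (i : Fin n) (u : ℕ) :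
    Integrable (fun x : Fin n → ℕ → ℝ => x i u) ρ :=
  (hρ.measurePreserving i u).integrable_comp_of_integrable (hint i)

theorem IsRoundLaw.integrable_compTime (hρ : IsRoundLaw ν ρ)
    (hint : ∀ i, Integrable (fun y => y) (ν i)) (ha : ∃ i, a i ≠ 0) :
    Integrable (compTime a) ρ := by
  refine Integrable.mono' (g := fun x => ∑ i, ∑ u ∈ Finset.range (a i), |x i u|) ?_
    (measurable_compTime a).aestronglyMeasurable
    (Filter.Eventually.of_forall fun x => abs_compTime_le ha x)
  exact integrable_finsetSum _ fun i _ => integrable_finsetSum _ fun u _ =>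
    (hρ.integrable_eval hint i u).abs

theorem IsRoundLaw.integrable_sum (hρ : IsRoundLaw ν ρ)
    (hint : ∀ i, Integrable (fun y => y) (ν i)) (i : Fin n) (m : ℕ) :
    Integrable (fun x : Fin n → ℕ → ℝ => ∑ u ∈ Finset.range m, x i u) ρ :=
  integrable_finsetSum _ fun u _ => hρ.integrable_eval hint i u

theorem IsRoundLaw.integral_sum (hρ : IsRoundLaw ν ρ)
    (hint : ∀ i, Integrable (fun y => y) (ν i)) (hmean : ∀ i, ∫ y, y ∂(ν i) = μ i)
    (i : Fin n) (m : ℕ) :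
    ∫ x : Fin n → ℕ → ℝ, ∑ u ∈ Finset.range m, x i u ∂ρ = m * μ i := by
  rw [integral_finsetSum _ fun u _ => hρ.integrable_eval hint i u]
  have : ∀ u, ∫ x : Fin n → ℕ → ℝ, x i u ∂ρ = μ i := fun u => by
    rw [← hmean i]
    exact hρ.integral_eval i u (f := fun y => y) (hint i).1
  simp [this]

/-- By Jensen's inequality, the proxy loss at the true means is a lower bound for the expected
computation time. -/
theorem IsRoundLaw.proxyLoss_le_meanTime (hρ : IsRoundLaw ν ρ)
    (hint : ∀ i, Integrable (fun y => y) (ν i)) (hmean : ∀ i, ∫ y, y ∂(ν i) = μ i)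
    (hμ : ∀ i, 0 < μ i) (ha : ∃ i, a i ≠ 0) : proxyLoss a μ ≤ meanTime ρ a := by
  have key : ∀ i, a i ≠ 0 → (a i : ℝ) * μ i ≤ meanTime ρ a := fun i hi => by
    rw [← hρ.integral_sum hint hmean i (a i)]
    exact integral_mono (hρ.integrable_sum hint i _) (hρ.integrable_compTime hint ha)
      fun x => sum_le_compTime x hi
  obtain ⟨j, hj⟩ := ha
  have : Nonempty (Fin n) := ⟨j⟩
  refine ciSup_le fun i => ?_
  by_cases hi : a i = 0
  · have := key j hj
    have h2 : 0 ≤ (a j : ℝ) * μ j := by have := hμ j; positivity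
    simp only [hi, Nat.cast_zero, zero_mul]
    linarith
  · exact key i hi

theorem IsRoundLaw.meanTime_le_sum (hρ : IsRoundLaw ν ρ)
    (hint : ∀ i, Integrable (fun y => y) (ν i)) (hmean : ∀ i, ∫ y, y ∂(ν i) = μ i)
    (hpos : ∀ i, ∀ᵐ y ∂(ν i), 0 < y) (ha : ∃ i, a i ≠ 0) :
    meanTime ρ a ≤ ∑ i, (a i : ℝ) * μ i := by
  have hsum : ∫ x : Fin n → ℕ → ℝ, ∑ i, ∑ u ∈ Finset.range (a i), x i u ∂ρ =
      ∑ i, (a i : ℝ) * μ i := by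
    rw [integral_finsetSum _ fun i _ => hρ.integrable_sum hint i _]
    simp_rw [hρ.integral_sum hint hmean]
  rw [← hsum]
  refine integral_mono_ae (hρ.integrable_compTime hint ha)
    (integrable_finsetSum _ fun i _ => hρ.integrable_sum hint i _) ?_
  have hx : ∀ᵐ x ∂ρ, ∀ i u, 0 < x i u :=
    ae_all_iff.2 fun i => ae_all_iff.2 fun u =>
      (hρ.measurePreserving i u).quasiMeasurePreserving.ae (hpos i)
  filter_upwards [hx] with x hx
  exact compTime_le ha fun i _ => Finset.single_le_sum
    (f := fun i => ∑ u ∈ Finset.range (a i), x i u)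
    (fun j _ => Finset.sum_nonneg fun u _ => (hx j u).le) (Finset.mem_univ i)

/-- The maximal inequality for finitely many sub-exponential workers. Instead of Jensen's inequality
it uses the tangent `y ≤ exp y / M + log M - 1` of the exponential at `log M`, where `M` is twice
the number of active workers. -/
theorem IsRoundLaw.meanTime_le_of_lintegral_exp [IsProbabilityMeasure ρ] (hρ : IsRoundLaw ν ρ)
    (hint : ∀ i, Integrable (fun y => y) (ν i)) (hμ : ∀ i, 0 < μ i) (ha : ∃ i, a i ≠ 0)
    {e : ℝ} (he : 0 < e)
    (hexp : ∀ i, ∫⁻ y, ENNReal.ofReal (Real.exp (|y - μ i| / (e * μ i))) ∂(ν i) ≤ 2) :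
    meanTime ρ a ≤ proxyLoss a μ +
      e * proxyLoss a μ * Real.log (2 * (Finset.univ.filter fun i => a i ≠ 0).card) := by
  set s := Finset.univ.filter fun i => a i ≠ 0 with hs
  set M : ℝ := 2 * s.card with hM
  set l := proxyLoss a μ with hl
  have hspos : 0 < s.card := by
    obtain ⟨i, hi⟩ := ha
    exact Finset.card_pos.2 ⟨i, by simp [hs, hi]⟩
  have hMpos : 0 < M := by positivity
  have hM1 : 0 ≤ Real.log M := Real.log_nonneg (by
    have : (1 : ℝ) ≤ s.card := by exact_mod_cast hspos
    linarith)
  have hl0 : 0 ≤ l := by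
    obtain ⟨i, hi⟩ := ha
    have := hμ i
    exact le_trans (by positivity) (le_proxyLoss a μ i)
  have tangent : ∀ y : ℝ, y ≤ Real.exp y / M + (Real.log M - 1) := fun y => by
    have h := Real.add_one_le_exp (y - Real.log M)
    rw [Real.exp_sub, Real.exp_log hMpos] at h
    linarith
  -- `g i x` is the average of the exponential moments over the tasks of worker `i`.
  set g : Fin n → (Fin n → ℕ → ℝ) → ℝ := fun i x =>
    (∑ u ∈ Finset.range (a i), Real.exp (|x i u - μ i| / (e * μ i))) / a i with hg
  have hg0 : ∀ i x, 0 ≤ g i x := fun i x => by positivity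
  have hEi : ∀ i u, Integrable
      (fun x : Fin n → ℕ → ℝ => Real.exp (|x i u - μ i| / (e * μ i))) ρ := fun i u =>
    (hρ.measurePreserving i u).integrable_comp_of_integrable
      (integrable_exp_of_lintegral_le_two (f := fun y => |y - μ i| / (e * μ i))
        (by fun_prop) (hexp i))
  have hgi : ∀ i, Integrable (g i) ρ := fun i =>
    (integrable_finsetSum _ fun u _ => hEi i u).div_const _
  have hg2 : ∀ i ∈ s, ∫ x, g i x ∂ρ ≤ 2 := fun i hi => by
    have hi' : a i ≠ 0 := by simpa [hs] using hi
    have hai : (0 : ℝ) < a i := by positivity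
    have h1 : ∀ u, ∫ x : Fin n → ℕ → ℝ, Real.exp (|x i u - μ i| / (e * μ i)) ∂ρ ≤ 2 := fun u => by
      rw [hρ.integral_eval i u (f := fun y => Real.exp (|y - μ i| / (e * μ i)))
        (by fun_prop)]
      exact integral_exp_le_two_of_lintegral_le_two (by fun_prop) (hexp i)
    rw [hg, integral_div, integral_finsetSum _ fun u _ => hEi i u, div_le_iff₀ hai]
    calc _ ≤ ∑ u ∈ Finset.range (a i), (2 : ℝ) := Finset.sum_le_sum fun u _ => h1 u
      _ = 2 * a i := by simp [mul_comm]
  have hpt : ∀ x, compTime a x ≤ l + e * l * ((∑ i ∈ s, g i x) / M + (Real.log M - 1)) := by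
    intro x
    refine compTime_le ha fun i hi => ?_
    have hai : (0 : ℝ) < a i := by positivity
    have hμi := hμ i
    have h1 : ∀ u, x i u ≤ μ i + e * μ i *
        (Real.exp (|x i u - μ i| / (e * μ i)) / M + (Real.log M - 1)) := fun u => by
      calc x i u ≤ μ i + |x i u - μ i| := by linarith [le_abs_self (x i u - μ i)]
        _ = μ i + e * μ i * (|x i u - μ i| / (e * μ i)) := by field_simp
        _ ≤ _ := by gcongr; exact tangent _
    have h2 : ∑ u ∈ Finset.range (a i), x i u ≤
        a i * μ i + e * (a i * μ i) * (g i x / M + (Real.log M - 1)) := by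
      refine (Finset.sum_le_sum fun u _ => h1 u).trans_eq ?_
      simp only [Finset.sum_add_distrib, ← Finset.mul_sum,
        ← Finset.sum_div, Finset.sum_const, Finset.card_range, nsmul_eq_mul, hg]
      field_simp
    have h3 : 0 ≤ g i x / M + (Real.log M - 1) := by
      have hbound : 1 ≤ g i x := by
        rw [hg, le_div_iff₀ hai, one_mul]
        calc (a i : ℝ) = ∑ u ∈ Finset.range (a i), (1 : ℝ) := by simp
          _ ≤ _ := Finset.sum_le_sum fun u _ => Real.one_le_exp (by positivity)
      have h4 := tangent 0
      rw [Real.exp_zero] at h4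
      have : 1 / M ≤ g i x / M := by gcongr
      linarith
    have h4 : g i x ≤ ∑ i ∈ s, g i x :=
      Finset.single_le_sum (f := fun i => g i x) (fun i _ => hg0 i x) (by simp [hs, hi])
    have h5 : (a i : ℝ) * μ i ≤ l := le_proxyLoss a μ i
    calc _ ≤ _ := h2
      _ ≤ l + e * l * (g i x / M + (Real.log M - 1)) := by gcongr
      _ ≤ _ := by gcongr
  have hI : Integrable (fun x => (∑ i ∈ s, g i x) / M + (Real.log M - 1)) ρ :=
    ((integrable_finsetSum _ fun i _ => hgi i).div_const _).add (integrable_const _)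
  calc meanTime ρ a ≤ ∫ x, l + e * l * ((∑ i ∈ s, g i x) / M + (Real.log M - 1)) ∂ρ :=
        integral_mono (hρ.integrable_compTime hint ha)
          ((integrable_const _).add (hI.const_mul _)) hpt
    _ = l + e * l * ((∑ i ∈ s, ∫ x, g i x ∂ρ) / M + (Real.log M - 1)) := by
        rw [integral_add (integrable_const _) (hI.const_mul _), integral_const_mul,
          integral_add ((integrable_finsetSum _ fun i _ => hgi i).div_const _)
            (integrable_const _), integral_div, integral_finsetSum _ fun i _ => hgi i]
        simp
    _ ≤ l + e * l * Real.log M := by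
        have : (∑ i ∈ s, ∫ x, g i x ∂ρ) / M ≤ 1 := by
          rw [div_le_one hMpos]
          calc _ ≤ ∑ i ∈ s, (2 : ℝ) := Finset.sum_le_sum hg2
            _ = M := by simp [hM, mul_comm]
        gcongr
        linarith

/-- The expected computation time exceeds the proxy loss at the true means by a factor of at most
`1 + 4 η log B`. With a single active worker there is no excess at all, and with at least two of them
`log (2 * card) ≤ 2 * log B`. -/
theorem IsRoundLaw.meanTime_le [IsProbabilityMeasure ρ] (hρ : IsRoundLaw ν ρ)
    (hint : ∀ i, Integrable (fun y => y) (ν i)) (hmean : ∀ i, ∫ y, y ∂(ν i) = μ i)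
    (hμ : ∀ i, 0 < μ i) (hfin : ∀ i, psi1Norm (ν i) (fun x => x - μ i) ≠ ∞)
    (hB : 0 < B) (ha : a ∈ allocations n B) :
    meanTime ρ a ≤ (1 + 4 * eta ν μ * Real.log B) * proxyLoss a μ := by
  have hne := exists_ne_zero_of_mem_allocations hB ha
  have hsum : ∑ i, a i = B := ha
  set s := Finset.univ.filter fun i => a i ≠ 0 with hs
  have hη : ∀ i, (psi1Norm (ν i) (fun x => x - μ i)).toReal / μ i ≤ eta ν μ := fun i =>
    le_ciSup (f := fun i => (psi1Norm (ν i) (fun x => x - μ i)).toReal / μ i)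
      (Set.finite_range _).bddAbove i
  have hη0 : 0 ≤ eta ν μ := by
    obtain ⟨i, -⟩ := hne
    have := hμ i
    exact le_trans (by positivity) (hη i)
  have hl0 : 0 ≤ proxyLoss a μ := by
    obtain ⟨i, hi⟩ := hne
    have := hμ i
    exact le_trans (by positivity) (le_proxyLoss a μ i)
  have hlogB : 0 ≤ Real.log B := Real.log_nonneg (by exact_mod_cast hB)
  have hsB : s.card ≤ B := by
    rw [← hsum, ← Finset.sum_filter_ne_zero, Finset.card_eq_sum_ones]
    exact Finset.sum_le_sum fun i hi => Nat.one_le_iff_ne_zero.2 (Finset.mem_filter.1 hi).2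
  obtain ⟨i, hi⟩ := hne
  have his : i ∈ s := by simp [hs, hi]
  have hspos : 0 < s.card := Finset.card_pos.2 ⟨i, his⟩
  rcases (show s.card = 1 ∨ 2 ≤ s.card by omega) with h1 | h2
  · have hone : ∀ j, a j ≠ 0 → j = i := fun j hj =>
      Finset.card_le_one.1 h1.le j (by simp [hs, hj]) i his
    have hle : meanTime ρ a ≤ a i * μ i := by
      rw [← hρ.integral_sum hint hmean i (a i)]
      refine integral_mono (hρ.integrable_compTime hint ⟨i, hi⟩) (hρ.integrable_sum hint i _)
        fun x => compTime_le ⟨i, hi⟩ fun j hj => ?_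
      rw [hone j hj]
    have h3 := le_proxyLoss a μ i
    have h4 : 0 ≤ 4 * eta ν μ * Real.log B * proxyLoss a μ := by positivity
    linarith
  · have hlog : Real.log (2 * s.card) ≤ 2 * Real.log B := by
      have h2' : (2 : ℝ) ≤ s.card := by exact_mod_cast h2
      have h3 : (s.card : ℝ) ≤ B := by exact_mod_cast hsB
      calc Real.log (2 * s.card) ≤ Real.log ((B : ℝ) ^ 2) :=
            Real.log_le_log (by positivity) (by nlinarith)
        _ = 2 * Real.log B := by rw [Real.log_pow]; norm_num
    have key : ∀ e, eta ν μ < e →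
        meanTime ρ a ≤ proxyLoss a μ + e * (2 * Real.log B * proxyLoss a μ) := fun e he => by
      have he0 : 0 < e := hη0.trans_lt he
      refine (hρ.meanTime_le_of_lintegral_exp hint hμ ⟨i, hi⟩ he0 fun j => ?_).trans ?_
      · refine lintegral_exp_le_two_of_psi1Norm_lt ?_
        rw [← ENNReal.ofReal_toReal (hfin j)]
        refine (ENNReal.ofReal_lt_ofReal_iff (mul_pos he0 (hμ j))).2 ?_
        exact (div_lt_iff₀ (hμ j)).1 ((hη j).trans_lt he)
      · have := mul_le_mul_of_nonneg_left hlog (mul_nonneg he0.le hl0)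
        linarith
    have hlim : Filter.Tendsto
        (fun e => proxyLoss a μ + e * (2 * Real.log B * proxyLoss a μ))
        (nhdsWithin (eta ν μ) (Set.Ioi (eta ν μ)))
        (nhds (proxyLoss a μ + eta ν μ * (2 * Real.log B * proxyLoss a μ))) :=
      (Continuous.tendsto (by fun_prop) _).mono_left nhdsWithin_le_nhds
    have h3 := ge_of_tendsto hlim (Filter.eventually_of_mem self_mem_nhdsWithin key)
    have h4 : 0 ≤ eta ν μ * (2 * Real.log B * proxyLoss a μ) := by positivity
    linarith

end RoundLaw

/-! ### Concentration of the empirical means -/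

section Chernoff

variable {Ω : Type*} [MeasurableSpace Ω] {P : Measure Ω} {α : ℝ} {S : Ω → ℝ} {N : Ω → ℕ}

/-- Markov's inequality for the exponential of `θ S - N θ² α²` on the event `N = m`. -/
theorem measure_le_exp_of_lintegral_exp_le_one (hS : Measurable S) (hN : Measurable N)
    {θ L : ℝ} (h : ∫⁻ ω, ENNReal.ofReal (Real.exp (θ * S ω - N ω * (θ ^ 2 * α ^ 2))) ∂P ≤ 1)
    {m : ℕ} {E : Set Ω} (hE : ∀ ω ∈ E, N ω = m ∧ L ≤ θ * S ω - m * (θ ^ 2 * α ^ 2)) :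
    P E ≤ ENNReal.ofReal (Real.exp (-L)) := by
  have hsub : E ⊆ {ω | ENNReal.ofReal (Real.exp L) ≤
      ENNReal.ofReal (Real.exp (θ * S ω - N ω * (θ ^ 2 * α ^ 2)))} := fun ω hω => by
    obtain ⟨h1, h2⟩ := hE ω hω
    simp only [Set.mem_ofPred_eq, h1]
    gcongr
  have hmeas : Measurable fun ω =>
      ENNReal.ofReal (Real.exp (θ * S ω - N ω * (θ ^ 2 * α ^ 2))) := by fun_prop
  have hpos : ENNReal.ofReal (Real.exp L) ≠ 0 := by simp [Real.exp_pos]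
  calc P E ≤ _ := measure_mono hsub
    _ ≤ _ := meas_ge_le_lintegral_div hmeas.aemeasurable hpos ENNReal.ofReal_ne_top
    _ ≤ 1 / ENNReal.ofReal (Real.exp L) := by gcongr
    _ = _ := by rw [one_div, ← ENNReal.ofReal_inv_of_pos (Real.exp_pos L), Real.exp_neg]

/-- Bernstein's inequality for a randomly stopped sum `S` on the event that it has `m` terms. -/
theorem measure_eq_and_lt_le_exp (hα : 0 ≤ α) (hS : Measurable S) (hN : Measurable N)
    (h : ∀ θ : ℝ, |θ| * α ≤ 1 →
      ∫⁻ ω, ENNReal.ofReal (Real.exp (θ * S ω - N ω * (θ ^ 2 * α ^ 2))) ∂P ≤ 1)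
    {m : ℕ} (hm : m ≠ 0) {L : ℝ} (hL : 0 ≤ L) :
    P {ω | N ω = m ∧ m * (2 * α * (Real.sqrt (L / m) + L / m)) < S ω} ≤
      ENNReal.ofReal (Real.exp (-L)) := by
  have hm' : (0 : ℝ) < m := by positivity
  rcases hα.eq_or_lt with rfl | hα
  · -- Without noise every `θ` is allowed; exhaust `{0 < S}` by the events `{1 / (j + 1) ≤ S}`.
    have hU : {ω | N ω = m ∧ m * (2 * 0 * (Real.sqrt (L / m) + L / m)) < S ω} =
        ⋃ j : ℕ, {ω | N ω = m ∧ 1 / ((j : ℝ) + 1) ≤ S ω} := by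
      ext ω
      simp only [mul_zero, zero_mul, Set.mem_ofPred_eq, Set.mem_iUnion, exists_and_left]
      refine and_congr_right fun _ => ⟨fun h0 => ?_, fun ⟨j, hj⟩ =>
        lt_of_lt_of_le (by positivity) hj⟩
      obtain ⟨j, hj⟩ := exists_nat_one_div_lt h0
      exact ⟨j, hj.le⟩
    have hmono : Monotone fun j : ℕ => {ω | N ω = m ∧ 1 / ((j : ℝ) + 1) ≤ S ω} :=
      fun j j' hj ω hω => ⟨hω.1, (Nat.one_div_le_one_div hj).trans hω.2⟩
    rw [hU, hmono.measure_iUnion]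
    refine iSup_le fun j => ?_
    refine measure_le_exp_of_lintegral_exp_le_one (m := m) hS hN
      (h (L * ((j : ℝ) + 1)) (by simp)) fun ω hω => ⟨hω.1, ?_⟩
    have hj : (0 : ℝ) < (j : ℝ) + 1 := by positivity
    have h1 := (div_le_iff₀ hj).1 hω.2
    nlinarith
  · -- The choice of `θ` that makes the exponent at least `L`.
    set r := Real.sqrt (L / m) with hr
    have hr0 : 0 ≤ r := Real.sqrt_nonneg _
    have hr2 : r ^ 2 = L / m := Real.sq_sqrt (by positivity)
    have hLr : L = m * r ^ 2 := by rw [hr2]; field_simp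
    set t := min r 1 with ht
    have ht0 : 0 ≤ t := le_min hr0 zero_le_one
    have hθ : |t / α| * α ≤ 1 := by
      rw [abs_of_nonneg (by positivity), div_mul_cancel₀ _ hα.ne']
      exact min_le_right _ _
    refine measure_le_exp_of_lintegral_exp_le_one (m := m) hS hN (h _ hθ) fun ω hω => ⟨hω.1, ?_⟩
    have h1 : t / α * (m * (2 * α * (r + r ^ 2))) ≤ t / α * S ω := by
      rw [hr2]
      exact mul_le_mul_of_nonneg_left hω.2.le (by positivity)
    have h2 : t / α * (m * (2 * α * (r + r ^ 2))) = m * (2 * t * (r + r ^ 2)) := by field_simp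
    have h3 : (t / α) ^ 2 * α ^ 2 = t ^ 2 := by field_simp
    have h4 : r ^ 2 ≤ 2 * t * (r + r ^ 2) - t ^ 2 := by
      rcases le_total r 1 with h | h
      · rw [ht, min_eq_left h]; nlinarith [pow_nonneg hr0 3]
      · rw [ht, min_eq_right h]; nlinarith
    rw [h3, hLr]
    nlinarith

/-- A union bound over the possible numbers of terms and over the two signs. -/
theorem measure_ne_zero_and_lt_abs_le (hα : 0 ≤ α) (hS : Measurable S) (hN : Measurable N)
    (h : ∀ θ : ℝ, |θ| * α ≤ 1 →
      ∫⁻ ω, ENNReal.ofReal (Real.exp (θ * S ω - N ω * (θ ^ 2 * α ^ 2))) ∂P ≤ 1)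
    {M : ℕ} (hM : ∀ ω, N ω ≤ M) {L : ℝ} (hL : 0 ≤ L) :
    P {ω | N ω ≠ 0 ∧ N ω * (2 * α * (Real.sqrt (L / N ω) + L / N ω)) < |S ω|} ≤
      ENNReal.ofReal (2 * M * Real.exp (-L)) := by
  have hneg : ∀ θ : ℝ, |θ| * α ≤ 1 →
      ∫⁻ ω, ENNReal.ofReal (Real.exp (θ * (-S ω) - N ω * (θ ^ 2 * α ^ 2))) ∂P ≤ 1 := fun θ hθ => by
    have := h (-θ) (by rwa [abs_neg])
    simpa only [neg_mul, mul_neg, neg_sq, even_two, Even.neg_pow] using this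
  have hsub : {ω | N ω ≠ 0 ∧ N ω * (2 * α * (Real.sqrt (L / N ω) + L / N ω)) < |S ω|} ⊆
      ⋃ m ∈ Finset.Icc 1 M,
        ({ω | N ω = m ∧ m * (2 * α * (Real.sqrt (L / m) + L / m)) < S ω} ∪
          {ω | N ω = m ∧ m * (2 * α * (Real.sqrt (L / m) + L / m)) < -S ω}) := by
    intro ω hω
    simp only [Set.mem_iUnion]
    refine ⟨N ω, Finset.mem_Icc.2 ⟨Nat.one_le_iff_ne_zero.2 hω.1, hM ω⟩, ?_⟩
    rcases lt_abs.1 hω.2 with h1 | h1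
    · exact Or.inl ⟨rfl, h1⟩
    · exact Or.inr ⟨rfl, h1⟩
  calc _ ≤ _ := measure_mono hsub
    _ ≤ ∑ m ∈ Finset.Icc 1 M, _ := measure_biUnion_finset_le _ _
    _ ≤ ∑ m ∈ Finset.Icc 1 M, ENNReal.ofReal (2 * Real.exp (-L)) := by
        refine Finset.sum_le_sum fun m hm => (measure_union_le _ _).trans ?_
        have hm0 : m ≠ 0 := by have := (Finset.mem_Icc.1 hm).1; omega
        rw [two_mul (Real.exp (-L)), ENNReal.ofReal_add (Real.exp_pos _).le (Real.exp_pos _).le]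
        exact add_le_add (measure_eq_and_lt_le_exp hα hS hN h hm0 hL)
          (measure_eq_and_lt_le_exp hα hS.neg hN hneg hm0 hL)
    _ = ENNReal.ofReal (2 * M * Real.exp (-L)) := by
        rw [Finset.sum_const, Nat.card_Icc, Nat.add_sub_cancel, nsmul_eq_mul,
          ← ENNReal.ofReal_natCast, ← ENNReal.ofReal_mul (Nat.cast_nonneg _)]
        congr 1
        ring

end Chernoff

section RoundLaw

variable {n : ℕ} {ν : Fin n → Measure ℝ} {ρ : Measure (Fin n → ℕ → ℝ)} {μ : Fin n → ℝ}

theorem IsRoundLaw.lintegral_exp_sum_le_one (hν : ∀ i, IsProbabilityMeasure (ν i))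
    (hρ : IsRoundLaw ν ρ) (hint : ∀ i, Integrable (fun y => y) (ν i))
    (hmean : ∀ i, ∫ y, y ∂(ν i) = μ i) {α : ℝ} (hα : 0 ≤ α)
    (hpsi : ∀ i, psi1Norm (ν i) (fun x => x - μ i) ≤ ENNReal.ofReal α) {θ : ℝ} (hθ : |θ| * α ≤ 1)
    (i : Fin n) (m : ℕ) :
    ∫⁻ x, ENNReal.ofReal (Real.exp (∑ u ∈ Finset.range m,
      (θ * (x i u - μ i) - θ ^ 2 * α ^ 2))) ∂ρ ≤ 1 := by
  set g : ℝ → ℝ≥0∞ := fun y => ENNReal.ofReal (Real.exp (θ * (y - μ i) - θ ^ 2 * α ^ 2)) with hg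
  have hgm : Measurable g := by fun_prop
  have hm : ∀ u, Measurable fun x : Fin n → ℕ → ℝ => x i u := fun u =>
    (hρ.measurePreserving i u).measurable
  have hind : iIndepFun (fun (u : ℕ) (x : Fin n → ℕ → ℝ) => g (x i u)) ρ :=
    (hρ.indep i).comp (fun _ => g) fun _ => hgm
  have hone : ∀ u, ∫⁻ x : Fin n → ℕ → ℝ, g (x i u) ∂ρ ≤ 1 := fun u => by
    rw [(hρ.measurePreserving i u).lintegral_comp hgm]
    have h0 : ∫ y, (y - μ i) ∂(ν i) = 0 := by
      rw [integral_sub (hint i) (integrable_const _), hmean i]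
      simp
    have h1 := lintegral_exp_mul_le hα (by fun_prop) h0 (hpsi i) hθ
    calc ∫⁻ y, g y ∂(ν i)
        = ∫⁻ y, ENNReal.ofReal (Real.exp (θ * (y - μ i))) *
            ENNReal.ofReal (Real.exp (-(θ ^ 2 * α ^ 2))) ∂(ν i) := by
          refine lintegral_congr fun y => ?_
          rw [← ENNReal.ofReal_mul (Real.exp_pos _).le, ← Real.exp_add, ← sub_eq_add_neg]
      _ ≤ ENNReal.ofReal (Real.exp (θ ^ 2 * α ^ 2)) *
            ENNReal.ofReal (Real.exp (-(θ ^ 2 * α ^ 2))) := by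
          rw [lintegral_mul_const _ (by fun_prop)]
          gcongr
      _ = 1 := by
          rw [← ENNReal.ofReal_mul (Real.exp_pos _).le, ← Real.exp_add]
          simp
  have hpt : ∀ x : Fin n → ℕ → ℝ, ENNReal.ofReal (Real.exp (∑ u ∈ Finset.range m,
      (θ * (x i u - μ i) - θ ^ 2 * α ^ 2))) = ∏ u ∈ Finset.range m, g (x i u) := fun x => by
    rw [Real.exp_sum, ENNReal.ofReal_prod_of_nonneg fun _ _ => (Real.exp_pos _).le]
  rw [lintegral_congr hpt, lintegral_prod_eq_prod_lintegral_of_indepFun _ _ hind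
    fun u => hgm.comp (hm u)]
  exact Finset.prod_le_one' fun u _ => hone u

end RoundLaw

/-- Decomposition of a quantity depending on a random allocation according to its value. -/
theorem eq_sum_indicator_of_mem_allocations {E : Type*} [AddCommMonoid E] {Ω : Type*} {n B : ℕ}
    {b : Ω → Fin n → ℕ}
    (hb : ∀ ω, b ω ∈ allocations n B) (F : (Fin n → ℕ) → Ω → E) (ω : Ω) :
    F (b ω) ω = ∑ c ∈ Finset.piAntidiag Finset.univ B, Set.indicator {ω | b ω = c} (F c) ω := by
  rw [Finset.sum_eq_single (b ω)]
  · exact (Set.indicator_of_mem (s := {ω' | b ω' = b ω}) rfl (F (b ω))).symm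
  · intro c _ hc
    exact Set.indicator_of_notMem (s := {ω' | b ω' = c}) (fun h => hc (Eq.symm h)) (F c)
  · intro h
    exact absurd (Finset.mem_piAntidiag.2 ⟨hb ω, by simp⟩) h

theorem measurable_sum_range {Ω : Type*} {n : ℕ} {mΩ : MeasurableSpace Ω} {N : Ω → ℕ}
    {Y : Ω → Fin n → ℕ → ℝ}
    (hN : Measurable N) (hY : Measurable Y) (i : Fin n) :
    Measurable fun ω => ∑ u ∈ Finset.range (N ω), Y ω i u := by
  have h : Measurable fun p : ℕ × (Fin n → ℕ → ℝ) => ∑ u ∈ Finset.range p.1, p.2 i u :=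
    measurable_from_prod_countable_right fun m => by
      change Measurable fun x : Fin n → ℕ → ℝ => ∑ u ∈ Finset.range m, x i u
      fun_prop
  exact h.comp (hN.prodMk hY)

theorem count_le {Ω : Type*} {n B : ℕ} {a : ℕ → Ω → Fin n → ℕ}
    (ha : ∀ k ω, a k ω ∈ allocations n B) (k : ℕ) (i : Fin n) (ω : Ω) :
    count (fun q => a q ω) k i ≤ B * k := by
  calc count (fun q => a q ω) k i ≤ ∑ _q ∈ Finset.range k, B :=
        Finset.sum_le_sum fun q _ => le_of_mem_allocations (ha q ω) i
    _ = B * k := by simp [mul_comm]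

section Rounds

variable {n B : ℕ} {Ω : Type*} [mΩ : MeasurableSpace Ω] {P : Measure Ω} {ℱ : Filtration ℕ mΩ}
  {ν : Fin n → Measure ℝ} {ρ : Measure (Fin n → ℕ → ℝ)} {μ : Fin n → ℝ} {α : ℝ}
  {X : ℕ → Ω → Fin n → ℕ → ℝ} {a : ℕ → Ω → Fin n → ℕ}

theorem measurable_count (ha : ∀ k, Measurable[ℱ k] (a k)) (k : ℕ) (i : Fin n) :
    Measurable[ℱ k] fun ω => count (fun q => a q ω) k i := by
  unfold count
  refine Finset.measurable_fun_sum _ fun q hq => ?_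
  exact (measurable_pi_apply i).comp
    ((ha q).mono (ℱ.mono (Finset.mem_range.1 hq).le) le_rfl)

theorem measurable_usageTime (ha : ∀ k, Measurable[ℱ k] (a k))
    (hX : ∀ k, Measurable[ℱ (k + 1)] (X k)) (k : ℕ) (i : Fin n) :
    Measurable[ℱ k] fun ω => usageTime (fun q => a q ω) (fun q => X q ω) k i := by
  unfold usageTime
  refine Finset.measurable_fun_sum _ fun q hq => ?_
  have hq := Finset.mem_range.1 hq
  exact measurable_sum_range
    ((measurable_pi_apply i).comp ((ha q).mono (ℱ.mono hq.le) le_rfl))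
    ((hX q).mono (ℱ.mono hq) le_rfl) i

/-- The exponential of the compensated total usage time is a supermartingale: given the past, the
allocation of a round is fixed and its times are fresh. -/
theorem lintegral_exp_usageTime_le_one [IsProbabilityMeasure P] (hT : IsTimes P ℱ ρ X)
    (hameas : ∀ k, Measurable[ℱ k] (a k)) (ha : ∀ k ω, a k ω ∈ allocations n B) {θ : ℝ} (i : Fin n)
    (hθ : ∀ m : ℕ, ∫⁻ x, ENNReal.ofReal (Real.exp (∑ u ∈ Finset.range m,
      (θ * (x i u - μ i) - θ ^ 2 * α ^ 2))) ∂ρ ≤ 1) (k : ℕ) :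
    ∫⁻ ω, ENNReal.ofReal (Real.exp (θ * (usageTime (fun q => a q ω) (fun q => X q ω) k i -
      count (fun q => a q ω) k i * μ i) - count (fun q => a q ω) k i * (θ ^ 2 * α ^ 2))) ∂P ≤ 1 := by
  induction k with
  | zero => simp [usageTime, count]
  | succ k ih =>
    refine le_trans ?_ ih
    set V : Ω → ℝ≥0∞ := fun ω =>
      ENNReal.ofReal (Real.exp (θ * (usageTime (fun q => a q ω) (fun q => X q ω) k i -
      count (fun q => a q ω) k i * μ i) - count (fun q => a q ω) k i * (θ ^ 2 * α ^ 2))) with hV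
    set g : (Fin n → ℕ) → (Fin n → ℕ → ℝ) → ℝ≥0∞ := fun b x =>
      ENNReal.ofReal (Real.exp (∑ u ∈ Finset.range (b i),
        (θ * (x i u - μ i) - θ ^ 2 * α ^ 2))) with hg
    have hgm : ∀ b, Measurable (g b) := fun b => by
      have h : Measurable fun x : Fin n → ℕ → ℝ => ∑ u ∈ Finset.range (b i),
          (θ * (x i u - μ i) - θ ^ 2 * α ^ 2) := by fun_prop
      exact h.exp.ennreal_ofReal
    have hVm : Measurable[ℱ k] V := by
      have h1 := measurable_usageTime hameas hT.measurable k i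
      have h2 : Measurable[ℱ k] fun ω => (count (fun q => a q ω) k i : ℝ) :=
        measurable_from_top.comp (measurable_count hameas k i)
      exact ((((h1.sub (h2.mul_const _)).const_mul θ).sub (h2.mul_const _)).exp).ennreal_ofReal
    have hstep : ∀ ω, ENNReal.ofReal (Real.exp (θ * (usageTime (fun q => a q ω)
        (fun q => X q ω) (k + 1) i - count (fun q => a q ω) (k + 1) i * μ i) -
        count (fun q => a q ω) (k + 1) i * (θ ^ 2 * α ^ 2))) = V ω * g (a k ω) (X k ω) := fun ω => by
      rw [hV, hg, ← ENNReal.ofReal_mul (Real.exp_pos _).le, ← Real.exp_add]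
      congr 2
      simp only [usageTime, count, Finset.sum_range_succ, Finset.sum_sub_distrib, ← Finset.mul_sum,
        Finset.sum_const, Finset.card_range, nsmul_eq_mul, Nat.cast_add]
      ring
    have hXm : Measurable (X k) := (hT.measurable k).mono (ℱ.le _) le_rfl
    have hset : ∀ c, MeasurableSet[ℱ k] {ω | a k ω = c} := fun c =>
      hameas k (measurableSet_singleton c)
    have hterm : ∀ c, ∫⁻ ω, Set.indicator {ω | a k ω = c} (fun ω => V ω * g c (X k ω)) ω ∂P ≤
        ∫⁻ ω, Set.indicator {ω | a k ω = c} V ω ∂P := fun c => by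
      have h1 : ∀ ω, Set.indicator {ω | a k ω = c} (fun ω => V ω * g c (X k ω)) ω =
          Set.indicator {ω | a k ω = c} V ω * g c (X k ω) := fun ω =>
        Set.indicator_mul_left _ _ _
      have h3 := lintegral_mul_eq_lintegral_mul_lintegral_of_independent_measurableSpace (ℱ.le k)
        hXm.comap_le (hT.indep k).symm (hVm.indicator (hset c))
        ((hgm c).comp (comap_measurable (X k)))
      rw [lintegral_congr h1]
      refine h3.trans_le ?_
      have h2 : ∫⁻ ω, g c (X k ω) ∂P ≤ 1 := by
        rw [← lintegral_map (hgm c) hXm, hT.law k]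
        exact hθ (c i)
      exact mul_le_of_le_one_right' h2
    rw [lintegral_congr hstep, lintegral_congr fun ω => eq_sum_indicator_of_mem_allocations (ha k)
        (fun c ω => V ω * g c (X k ω)) ω, lintegral_finsetSum',
      lintegral_congr fun ω => eq_sum_indicator_of_mem_allocations (ha k) (fun _ => V) ω,
      lintegral_finsetSum']
    · exact Finset.sum_le_sum fun c _ => hterm c
    · exact fun c _ => ((hVm.indicator (hset c)).mono (ℱ.le k) le_rfl).aemeasurable
    · exact fun c _ => (((hVm.mono (ℱ.le k) le_rfl).mul ((hgm c).comp hXm)).indicator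
        (ℱ.le k _ (hset c))).aemeasurable

/-- The event that before round `k` the empirical mean of some worker is outside of its confidence
interval. It is stated without division; a worker without samples is not counted. -/
def badEvent (μ : Fin n → ℝ) (α : ℝ) (X : ℕ → Ω → Fin n → ℕ → ℝ) (a : ℕ → Ω → Fin n → ℕ) (k : ℕ) :
    Set Ω :=
  {ω | ∃ i, count (fun q => a q ω) k i ≠ 0 ∧
    count (fun q => a q ω) k i * conf α k (count (fun q => a q ω) k i) <
      |usageTime (fun q => a q ω) (fun q => X q ω) k i - count (fun q => a q ω) k i * μ i|}

/-- The logarithm in `conf` is chosen such that the union bound over at most `B k` sample sizes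
leaves a harmonic term. -/
theorem measure_badEvent_le [IsProbabilityMeasure P] (hν : ∀ i, IsProbabilityMeasure (ν i))
    (hρ : IsRoundLaw ν ρ) (hint : ∀ i, Integrable (fun y => y) (ν i))
    (hmean : ∀ i, ∫ y, y ∂(ν i) = μ i) (hα : 0 ≤ α)
    (hpsi : ∀ i, psi1Norm (ν i) (fun x => x - μ i) ≤ ENNReal.ofReal α) (hT : IsTimes P ℱ ρ X)
    (hameas : ∀ k, Measurable[ℱ k] (a k)) (ha : ∀ k ω, a k ω ∈ allocations n B) (k : ℕ) :
    P (badEvent μ α X a k) ≤ ENNReal.ofReal (n * B * (1 / ((k : ℝ) + 1))) := by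
  have hL : 0 ≤ Real.log (2 * ((k : ℝ) + 1) ^ 2) := Real.log_nonneg (by
    have : (0 : ℝ) ≤ k := Nat.cast_nonneg k
    nlinarith)
  have hN : ∀ i, Measurable fun ω => count (fun q => a q ω) k i := fun i =>
    (measurable_count hameas k i).mono (ℱ.le k) le_rfl
  have hS : ∀ i, Measurable fun ω => usageTime (fun q => a q ω) (fun q => X q ω) k i -
      count (fun q => a q ω) k i * μ i := fun i => by
    have h1 := (measurable_usageTime hameas hT.measurable k i).mono (ℱ.le k) le_rfl
    have h2 : Measurable fun ω => (count (fun q => a q ω) k i : ℝ) :=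
      measurable_from_top.comp (hN i)
    exact h1.sub (h2.mul_const _)
  have hi : ∀ i, P {ω | count (fun q => a q ω) k i ≠ 0 ∧
      count (fun q => a q ω) k i * conf α k (count (fun q => a q ω) k i) <
      |usageTime (fun q => a q ω) (fun q => X q ω) k i - count (fun q => a q ω) k i * μ i|} ≤
      ENNReal.ofReal (B * (1 / ((k : ℝ) + 1))) := fun i => by
    refine (measure_ne_zero_and_lt_abs_le hα (hS i) (hN i) (fun θ hθ =>
      lintegral_exp_usageTime_le_one hT hameas ha i (fun m =>
        hρ.lintegral_exp_sum_le_one hν hint hmean hα hpsi hθ i m) k)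
      (M := B * k) (fun ω => count_le ha k i ω) hL).trans ?_
    refine ENNReal.ofReal_le_ofReal ?_
    rw [Real.exp_neg, Real.exp_log (by positivity)]
    push_cast
    calc 2 * ((B : ℝ) * k) * (2 * ((k : ℝ) + 1) ^ 2)⁻¹
        = B * (k / ((k : ℝ) + 1) ^ 2) := by field_simp
      _ ≤ B * (1 / ((k : ℝ) + 1)) := by
          refine mul_le_mul_of_nonneg_left ?_ (Nat.cast_nonneg B)
          rw [div_le_div_iff₀ (by positivity) (by positivity)]
          nlinarith [(Nat.cast_nonneg k : (0 : ℝ) ≤ k)]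
  have hU : badEvent μ α X a k = ⋃ i, {ω | count (fun q => a q ω) k i ≠ 0 ∧
      count (fun q => a q ω) k i * conf α k (count (fun q => a q ω) k i) <
      |usageTime (fun q => a q ω) (fun q => X q ω) k i - count (fun q => a q ω) k i * μ i|} := by
    ext ω
    simp [badEvent]
  calc P (badEvent μ α X a k) ≤ ∑ i : Fin n, _ := by
        rw [hU]
        exact measure_iUnion_fintype_le _ _
    _ ≤ ∑ _i : Fin n, ENNReal.ofReal (B * (1 / ((k : ℝ) + 1))) :=
        Finset.sum_le_sum fun i _ => hi i
    _ = _ := by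
        rw [Finset.sum_const, Finset.card_univ, Fintype.card_fin, nsmul_eq_mul,
          ← ENNReal.ofReal_natCast, ← ENNReal.ofReal_mul (Nat.cast_nonneg _), mul_assoc]

end Rounds

section Rounds

variable {n B : ℕ} {Ω : Type*} [mΩ : MeasurableSpace Ω] {P : Measure Ω} {ℱ : Filtration ℕ mΩ}
  {ν : Fin n → Measure ℝ} {ρ : Measure (Fin n → ℕ → ℝ)} {μ : Fin n → ℝ} {α : ℝ}
  {X : ℕ → Ω → Fin n → ℕ → ℝ} {a : ℕ → Ω → Fin n → ℕ}

theorem measurableSet_badEvent (hX : ∀ k, Measurable[ℱ (k + 1)] (X k))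
    (ha : ∀ k, Measurable[ℱ k] (a k)) (k : ℕ) : MeasurableSet (badEvent μ α X a k) := by
  have hN : ∀ i, Measurable fun ω => count (fun q => a q ω) k i := fun i =>
    (measurable_count ha k i).mono (ℱ.le k) le_rfl
  have hS : ∀ i, Measurable fun ω => usageTime (fun q => a q ω) (fun q => X q ω) k i := fun i =>
    (measurable_usageTime ha hX k i).mono (ℱ.le k) le_rfl
  have hf : ∀ f : ℕ → ℝ, ∀ i, Measurable fun ω => f (count (fun q => a q ω) k i) := fun f i =>
    measurable_from_top.comp (hN i)
  have hU : badEvent μ α X a k = ⋃ i, ({ω | count (fun q => a q ω) k i ≠ 0} ∩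
      {ω | count (fun q => a q ω) k i * conf α k (count (fun q => a q ω) k i) <
      |usageTime (fun q => a q ω) (fun q => X q ω) k i - count (fun q => a q ω) k i * μ i|}) := by
    ext ω
    simp [badEvent]
  rw [hU]
  refine MeasurableSet.iUnion fun i => MeasurableSet.inter ?_ ?_
  · exact (hN i (measurableSet_singleton 0)).compl
  · exact measurableSet_lt (hf (fun m => m * conf α k m) i)
      ((hS i).sub (hf (fun m => m * μ i) i)).abs

/-! ### The expected cost of an adaptively chosen allocation -/

theorem integrable_meanTime (hameas : ∀ k, Measurable[ℱ k] (a k)) [IsProbabilityMeasure P]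
    (ha : ∀ k ω, a k ω ∈ allocations n B) (k : ℕ) :
    Integrable (fun ω => meanTime ρ (a k ω)) P := by
  have h := eq_sum_indicator_of_mem_allocations (ha k) (fun c (_ : Ω) => meanTime ρ c)
  simp only [h]
  exact integrable_finsetSum _ fun c _ => (integrable_const _).indicator
    (ℱ.le k _ (hameas k (measurableSet_singleton c)))

theorem IsTimes.integrable_compTime (hT : IsTimes P ℱ ρ X) (hB : 0 < B) (hρ : IsRoundLaw ν ρ)
    (hint : ∀ i, Integrable (fun y => y) (ν i)) (hameas : ∀ k, Measurable[ℱ k] (a k))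
    (ha : ∀ k ω, a k ω ∈ allocations n B) (k : ℕ) :
    Integrable (fun ω => compTime (a k ω) (X k ω)) P := by
  have h := eq_sum_indicator_of_mem_allocations (ha k) (fun c ω => compTime c (X k ω))
  simp only [h]
  refine integrable_finsetSum _ fun c hc => Integrable.indicator ?_
    (ℱ.le k _ (hameas k (measurableSet_singleton c)))
  have hc' : c ∈ allocations n B := (Finset.mem_piAntidiag.1 hc).1
  have hXm : Measurable (X k) := (hT.measurable k).mono (ℱ.le _) le_rfl
  have hI := hρ.integrable_compTime hint (exists_ne_zero_of_mem_allocations hB hc')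
  rw [← hT.law k] at hI
  exact hI.comp_measurable hXm

/-- The times of a round are independent of the past, so that the expected computation time given
the past is that of the chosen allocation. -/
theorem IsTimes.integral_compTime [IsProbabilityMeasure P] (hT : IsTimes P ℱ ρ X) (hB : 0 < B)
    (hρ : IsRoundLaw ν ρ) (hint : ∀ i, Integrable (fun y => y) (ν i))
    (hameas : ∀ k, Measurable[ℱ k] (a k)) (ha : ∀ k ω, a k ω ∈ allocations n B) (k : ℕ) :
    ∫ ω, compTime (a k ω) (X k ω) ∂P = ∫ ω, meanTime ρ (a k ω) ∂P := by
  have h1 := eq_sum_indicator_of_mem_allocations (ha k) (fun c ω => compTime c (X k ω))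
  have h2 := eq_sum_indicator_of_mem_allocations (ha k) (fun c (_ : Ω) => meanTime ρ c)
  have hset : ∀ c, MeasurableSet[ℱ k] {ω | a k ω = c} := fun c =>
    hameas k (measurableSet_singleton c)
  have hXm : Measurable (X k) := (hT.measurable k).mono (ℱ.le _) le_rfl
  simp only [h1, h2]
  rw [integral_finsetSum, integral_finsetSum]
  · refine Finset.sum_congr rfl fun c _ => ?_
    rw [integral_indicator (ℱ.le k _ (hset c)), integral_indicator (ℱ.le k _ (hset c)),
      (hT.indep k).symm.setIntegral_eq_mul (ℱ.le k) hXm.aemeasurable (hset c)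
        (measurable_compTime c).aestronglyMeasurable, setIntegral_const, smul_eq_mul]
    congr 1
    rw [meanTime, ← hT.law k, integral_map hXm.aemeasurable
      (measurable_compTime c).aestronglyMeasurable]
  · exact fun c _ => (integrable_const _).indicator (ℱ.le k _ (hset c))
  · intro c hc
    have hc' : c ∈ allocations n B := (Finset.mem_piAntidiag.1 hc).1
    have hI := hρ.integrable_compTime hint (exists_ne_zero_of_mem_allocations hB hc')
    rw [← hT.law k] at hI
    exact (hI.comp_measurable hXm).indicator (ℱ.le k _ (hset c))

end Rounds

/-! ### Counting the suboptimal rounds -/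

section Counting

variable {n B : ℕ}

/-- A worker is used in at most `N + 1` rounds before which it has done at most `N` tasks, since
each such round raises its number of tasks. -/
theorem card_filter_count_le (a : ℕ → Fin n → ℕ) (i : Fin n) (N K : ℕ) :
    ((Finset.range K).filter fun k => a k i ≠ 0 ∧ count a k i ≤ N).card ≤ N + 1 := by
  have hlt : ∀ k k', a k i ≠ 0 → k < k' → count a k i < count a k' i := fun k k' hk hkk' => by
    have h1 : count a (k + 1) i ≤ count a k' i :=
      Finset.sum_le_sum_of_subset (Finset.range_mono hkk')
    have h2 : count a (k + 1) i = count a k i + a k i := Finset.sum_range_succ _ _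
    omega
  rw [← Finset.card_range (N + 1)]
  refine Finset.card_le_card_of_injOn (fun k => count a k i) (fun k hk => ?_) ?_
  · have := (Finset.mem_filter.1 hk).2.2
    simp only [Finset.coe_range, Set.mem_Iio]
    omega
  · intro k hk k' hk' h
    have hk := (Finset.mem_filter.1 hk).2.1
    have hk' := (Finset.mem_filter.1 hk').2.1
    simp only at h
    rcases lt_trichotomy k k' with h1 | h1 | h1
    · have := hlt k k' hk h1
      omega
    · exact h1
    · have := hlt k' k hk' h1
      omega

theorem exists_pos_forall_add_le (s : Finset ℝ) (l : ℝ) :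
    ∃ d : ℝ, 0 < d ∧ ∀ x ∈ s, l < x → l + d ≤ x := by
  rcases (s.filter fun x => l < x).eq_empty_or_nonempty with h | h
  · refine ⟨1, one_pos, fun x hx hlx => ?_⟩
    exact absurd (Finset.mem_filter.2 ⟨hx, hlx⟩) (by simp [h])
  · have hmin := Finset.mem_filter.1 (Finset.min'_mem _ h)
    refine ⟨(s.filter fun x => l < x).min' h - l, sub_pos.2 hmin.2, fun x hx hlx => ?_⟩
    have := Finset.min'_le _ x (Finset.mem_filter.2 ⟨hx, hlx⟩)
    linarith

/-- A confidence interval that is still wide has seen few samples. -/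
theorem mul_sq_le_of_le_conf {α δ L : ℝ} (hα : 0 ≤ α) (hδ : 0 < δ) (hL : 0 ≤ L) {m : ℕ}
    (hm : m ≠ 0) (h : δ ≤ 2 * (2 * α * (Real.sqrt (L / m) + L / m))) :
    m * (min 1 (δ / (8 * (α + 1)))) ^ 2 ≤ L := by
  have hm' : (0 : ℝ) < m := by positivity
  set r := Real.sqrt (L / m) with hr
  have hr0 : 0 ≤ r := Real.sqrt_nonneg _
  have hr2 : r ^ 2 = L / m := Real.sq_sqrt (by positivity)
  set q := min 1 (δ / (8 * (α + 1))) with hq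
  have hq0 : 0 ≤ q := by positivity
  have hqr : q ≤ r := by
    by_contra! hlt
    have h1 : q ≤ 1 := min_le_left _ _
    have h2 : 8 * (α + 1) * q ≤ δ := by
      have := (le_div_iff₀ (by positivity)).1 (min_le_right 1 (δ / (8 * (α + 1))))
      linarith
    rw [← hr2] at h
    have h3 : r ^ 2 ≤ r := by nlinarith
    have h4 : α * r ^ 2 ≤ α * r := by gcongr
    have h5 : α * r ≤ α * q := by gcongr
    nlinarith
  have h1 : q ^ 2 ≤ r ^ 2 := by gcongr
  rw [hr2, le_div_iff₀ hm'] at h1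
  linarith

theorem log_two_mul_sq_le {k K : ℕ} (hK : 2 ≤ K) (hk : k < K) :
    Real.log (2 * ((k : ℝ) + 1) ^ 2) ≤ 3 * Real.log K := by
  have h1 : (k : ℝ) + 1 ≤ K := by exact_mod_cast hk
  have h2 : (2 : ℝ) ≤ K := by exact_mod_cast hK
  have h3 : Real.log ((K : ℝ) ^ 3) = 3 * Real.log K := by rw [Real.log_pow]; norm_num
  rw [← h3]
  refine Real.log_le_log (by positivity) ?_
  calc 2 * ((k : ℝ) + 1) ^ 2 ≤ K * (K : ℝ) ^ 2 := by gcongr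
    _ = (K : ℝ) ^ 3 := by ring

/-- If the confidence intervals are correct and the chosen allocation is suboptimal for the true
means, then it uses a worker with few samples: optimism bounds the proxy loss at the lower
confidence bounds by the optimal value `l`, so the worker that attains the true proxy loss has a
confidence interval of width at least `d / B`, where `d` is the gap above `l`. -/
theorem exists_count_mul_sq_le {a : ℕ → Fin n → ℕ} {x : ℕ → Fin n → ℕ → ℝ} {α l d : ℝ}
    {μ : Fin n → ℝ} {k K : ℕ} {b : Fin n → ℕ} (hα : 0 ≤ α) (hB : 0 < B) (hμ : ∀ i, 0 < μ i)
    (hbest : IsBestAllocation B (fun b => proxyLoss b (lcb α a x k)) (a k))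
    (hgood : ∀ i, count a k i ≠ 0 →
      |usageTime a x k i - count a k i * μ i| ≤ count a k i * conf α k (count a k i))
    (hb : b ∈ allocations n B) (hl : proxyLoss b μ = l) (hd : 0 < d)
    (hgap : ∀ i, ∀ j ≤ B, l < j * μ i → l + d ≤ j * μ i)
    (hsub : l < proxyLoss (a k) μ) (hK : 2 ≤ K) (hk : k < K) :
    ∃ i, a k i ≠ 0 ∧
      count a k i * (min 1 (d / B / (8 * (α + 1)))) ^ 2 ≤ 3 * Real.log K := by
  have hemp : ∀ i, count a k i ≠ 0 →
      |empMean a x k i - μ i| ≤ conf α k (count a k i) := fun i hi => by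
    have hpos : (0 : ℝ) < count a k i := by positivity
    have h1 : empMean a x k i - μ i =
        (usageTime a x k i - count a k i * μ i) / count a k i := by
      rw [empMean]
      field_simp
    rw [h1, abs_div, abs_of_pos hpos, div_le_iff₀ hpos, mul_comm (conf _ _ _)]
    exact hgood i hi
  have hlcb : ∀ i, lcb α a x k i ≤ μ i := fun i => by
    rw [lcb]
    split_ifs with h0
    · exact (hμ i).le
    · have := (abs_le.1 (hemp i h0)).2
      exact max_le (by linarith) (hμ i).le
  obtain ⟨i₀, -⟩ := exists_ne_zero_of_mem_allocations hB hb
  have : Nonempty (Fin n) := ⟨i₀⟩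
  obtain ⟨i, hi⟩ := exists_lt_of_lt_ciSup hsub
  have hl0 : 0 ≤ l := by
    have := hμ i₀
    rw [← hl]
    exact le_trans (by positivity) (le_proxyLoss b μ i₀)
  have hai : a k i ≠ 0 := fun h => by
    simp only [h, Nat.cast_zero, zero_mul] at hi
    linarith
  refine ⟨i, hai, ?_⟩
  have hiB := le_of_mem_allocations hbest.1 i
  have hBpos : (0 : ℝ) < B := by exact_mod_cast hB
  have h1 : (a k i : ℝ) * lcb α a x k i ≤ l := by
    calc _ ≤ proxyLoss (a k) (lcb α a x k) := le_proxyLoss _ _ i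
      _ ≤ proxyLoss b (lcb α a x k) := hbest.2 b hb
      _ ≤ proxyLoss b μ := ciSup_le fun j =>
          (mul_le_mul_of_nonneg_left (hlcb j) (Nat.cast_nonneg _)).trans (le_proxyLoss b μ j)
      _ = l := hl
  have h2 : d ≤ B * (μ i - lcb α a x k i) := by
    have h3 := hgap i (a k i) hiB hi
    have h4 : (a k i : ℝ) * (μ i - lcb α a x k i) ≤ B * (μ i - lcb α a x k i) :=
      mul_le_mul_of_nonneg_right (by exact_mod_cast hiB) (sub_nonneg.2 (hlcb i))
    linarith
  have h3 : d / B ≤ μ i - lcb α a x k i := by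
    rw [div_le_iff₀ hBpos]
    linarith
  by_cases h0 : count a k i = 0
  · have : 0 ≤ Real.log K := Real.log_natCast_nonneg K
    simp only [h0, Nat.cast_zero, zero_mul]
    positivity
  · have h4 : empMean a x k i - conf α k (count a k i) ≤ lcb α a x k i := by
      rw [lcb, if_neg h0]
      exact le_max_left _ _
    have h5 := (abs_le.1 (hemp i h0)).1
    have h6 : d / B ≤ 2 * conf α k (count a k i) := by linarith
    refine (mul_sq_le_of_le_conf hα (by positivity) ?_ h0 h6).trans (log_two_mul_sq_le hK hk)
    refine Real.log_nonneg ?_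
    nlinarith [(Nat.cast_nonneg k : (0 : ℝ) ≤ k)]

theorem sum_range_one_div_le (K : ℕ) :
    ∑ k ∈ Finset.range K, 1 / ((k : ℝ) + 1) ≤ 1 + Real.log K := by
  have h := harmonic_le_one_add_log K
  simp only [harmonic, Rat.cast_sum, Rat.cast_inv, Rat.cast_add, Rat.cast_natCast,
    Rat.cast_one, Nat.cast_add, Nat.cast_one] at h
  simpa only [one_div] using h

end Counting

/-! ### The regret bound -/

theorem integrable_of_psi1Norm_sub_le {P : Measure ℝ} [IsProbabilityMeasure P] {m α : ℝ}
    (hα : 0 ≤ α) (h : psi1Norm P (fun x => x - m) ≤ ENNReal.ofReal α) :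
    Integrable (fun y => y) P := by
  have hα1 : 0 < α + 1 := by positivity
  have h1 := integrable_of_lintegral_exp_le_two hα1 (by fun_prop)
    (lintegral_exp_le_two_of_psi1Norm_le hα1 (by fun_prop)
      (h.trans (ENNReal.ofReal_le_ofReal (by linarith))))
  simpa only [Pi.add_def, sub_add_cancel] using h1.add (integrable_const m)

theorem integral_pos_of_ae_pos {P : Measure ℝ} [IsProbabilityMeasure P]
    (hint : Integrable (fun y => y) P) (hpos : ∀ᵐ y ∂P, 0 < y) : 0 < ∫ y, y ∂P := by
  have h0 : 0 ≤ᵐ[P] fun y : ℝ => y := hpos.mono fun y hy => le_of_lt hy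
  refine lt_of_le_of_ne (integral_nonneg_of_ae h0) fun h => ?_
  have h1 := (integral_eq_zero_iff_of_nonneg_ae h0 hint).1 h.symm
  obtain ⟨y, hy1, hy2⟩ := (h1.and hpos).exists
  exact hy2.ne' hy1

/-- The constant of the regret bound. A suboptimal choice despite correct confidence intervals uses
a worker with at most `3 log K / q ^ 2` samples. The factor `B * ∑ i, μ i` bounds the expected cost
of a round, the first summand pays for the rounds with an incorrect confidence interval and the
second one for the other suboptimal rounds. -/
noncomputable def regretConst (n B : ℕ) (μ : Fin n → ℝ) (q : ℝ) : ℝ :=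
  (B * ∑ i, μ i) * (n * B * (1 / Real.log 2 + 1) + n * (3 / q ^ 2 + 1 / Real.log 2))

section

variable {n B : ℕ} {Ω : Type*} [mΩ : MeasurableSpace Ω] {P : Measure Ω} {ℱ : Filtration ℕ mΩ}
  {ν : Fin n → Measure ℝ} {ρ : Measure (Fin n → ℕ → ℝ)} {μ : Fin n → ℝ} {α : ℝ}
  {X : ℕ → Ω → Fin n → ℕ → ℝ} {a : ℕ → Ω → Fin n → ℕ}

/-- Pathwise regret bound: a round costs at most `R` if its allocation is optimal for the proxy loss
and at most `M` otherwise. Suboptimal rounds with an incorrect confidence interval are counted by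
indicators, the other ones by `card_filter_count_le`. -/
theorem sum_meanTime_le {R M l d : ℝ} {b : Fin n → ℕ} (hα : 0 ≤ α) (hB : 0 < B)
    (hμ : ∀ i, 0 < μ i) (hA : IsATA B α ℱ X a) (hb : b ∈ allocations n B)
    (hl : proxyLoss b μ = l) (hd : 0 < d)
    (hgap : ∀ i, ∀ j ≤ B, l < (j : ℝ) * μ i → l + d ≤ j * μ i) (hR : 0 ≤ R) (hM : 0 ≤ M)
    (hopt : ∀ c ∈ allocations n B, proxyLoss c μ ≤ l → meanTime ρ c ≤ R)
    (hall : ∀ c ∈ allocations n B, meanTime ρ c ≤ M) {K : ℕ} (hK : 2 ≤ K) (ω : Ω) :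
    ∑ k ∈ Finset.range K, meanTime ρ (a k ω) ≤ K * R +
      M * (∑ k ∈ Finset.range K, (badEvent μ α X a k).indicator (fun _ => (1 : ℝ)) ω +
        n * (3 * Real.log K / (min 1 (d / B / (8 * (α + 1)))) ^ 2 + 1)) := by
  classical
  set q := min 1 (d / B / (8 * (α + 1))) with hq
  have hBpos : (0 : ℝ) < B := by exact_mod_cast hB
  have hqpos : 0 < q := lt_min one_pos (by positivity)
  have hlogK : 0 ≤ Real.log K := Real.log_natCast_nonneg K
  set N := ⌊3 * Real.log K / q ^ 2⌋₊ with hN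
  set T : Fin n → ℕ → ℝ := fun i k =>
    if a k ω i ≠ 0 ∧ count (fun q => a q ω) k i ≤ N then 1 else 0 with hTdef
  have hT0 : ∀ i k, 0 ≤ T i k := fun i k => by
    simp only [hTdef]
    split_ifs <;> norm_num
  have hind0 : ∀ k, 0 ≤ (badEvent μ α X a k).indicator (fun _ => (1 : ℝ)) ω := fun k =>
    Set.indicator_nonneg (fun _ _ => zero_le_one) _
  have hround : ∀ k ∈ Finset.range K, meanTime ρ (a k ω) ≤
      R + M * ((badEvent μ α X a k).indicator (fun _ => (1 : ℝ)) ω + ∑ i, T i k) := by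
    intro k hk
    have hk := Finset.mem_range.1 hk
    have hakω := (hA.argmin k ω).1
    have hsumT : 0 ≤ ∑ i, T i k := Finset.sum_nonneg fun i _ => hT0 i k
    rcases le_or_gt (proxyLoss (a k ω) μ) l with h | h
    · have h1 := hopt _ hakω h
      have h2 := mul_nonneg hM (add_nonneg (hind0 k) hsumT)
      linarith
    · have h1 : 1 ≤ (badEvent μ α X a k).indicator (fun _ => (1 : ℝ)) ω + ∑ i, T i k := by
        by_cases hbad : ω ∈ badEvent μ α X a k
        · rw [Set.indicator_of_mem hbad]
          linarith
        · have hgood : ∀ i, count (fun q => a q ω) k i ≠ 0 →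
              |usageTime (fun q => a q ω) (fun q => X q ω) k i -
                count (fun q => a q ω) k i * μ i| ≤
              count (fun q => a q ω) k i * conf α k (count (fun q => a q ω) k i) := fun i hi => by
            by_contra! hlt
            exact hbad ⟨i, hi, hlt⟩
          obtain ⟨i, hi1, hi2⟩ := exists_count_mul_sq_le (a := fun q => a q ω) hα hB hμ
            (hA.argmin k ω) hgood hb hl hd hgap h hK hk
          have h3 : T i k = 1 := by
            refine if_pos ⟨hi1, Nat.le_floor ?_⟩
            rw [le_div_iff₀ (by positivity)]
            exact hi2
          have h4 : T i k ≤ ∑ i, T i k :=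
            Finset.single_le_sum (f := fun i => T i k) (fun i _ => hT0 i k) (Finset.mem_univ i)
          have := hind0 k
          linarith
      have h2 := hall _ hakω
      have h3 := mul_le_mul_of_nonneg_left h1 hM
      linarith
  have hcount : ∑ k ∈ Finset.range K, ∑ i, T i k ≤ n * (3 * Real.log K / q ^ 2 + 1) := by
    rw [Finset.sum_comm]
    have hi : ∀ i, ∑ k ∈ Finset.range K, T i k ≤ 3 * Real.log K / q ^ 2 + 1 := fun i => by
      simp only [hTdef]
      rw [Finset.sum_boole]
      have h1 := card_filter_count_le (fun q => a q ω) i N K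
      have h2 : (N : ℝ) ≤ 3 * Real.log K / q ^ 2 := Nat.floor_le (by positivity)
      calc _ ≤ ((N + 1 : ℕ) : ℝ) := by exact_mod_cast h1
        _ ≤ _ := by push_cast; linarith
    calc _ ≤ ∑ _i : Fin n, (3 * Real.log K / q ^ 2 + 1) := Finset.sum_le_sum fun i _ => hi i
      _ = _ := by rw [Finset.sum_const, Finset.card_univ, Fintype.card_fin, nsmul_eq_mul]
  calc _ ≤ ∑ k ∈ Finset.range K,
        (R + M * ((badEvent μ α X a k).indicator (fun _ => (1 : ℝ)) ω + ∑ i, T i k)) :=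
        Finset.sum_le_sum hround
    _ = K * R + M * (∑ k ∈ Finset.range K, (badEvent μ α X a k).indicator (fun _ => (1 : ℝ)) ω +
          ∑ k ∈ Finset.range K, ∑ i, T i k) := by
        rw [Finset.sum_add_distrib, ← Finset.mul_sum, Finset.sum_add_distrib]
        simp
    _ ≤ _ := by gcongr

theorem totalTime_le [IsProbabilityMeasure P] (hα : 0 ≤ α) (hB : 0 < B)
    (hν : ∀ i, IsProbabilityMeasure (ν i)) (hmean : ∀ i, ∫ y, y ∂(ν i) = μ i)
    (hpos : ∀ i, ∀ᵐ y ∂(ν i), 0 < y)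
    (hpsi : ∀ i, psi1Norm (ν i) (fun x => x - μ i) ≤ ENNReal.ofReal α)
    (hρ : IsRoundLaw ν ρ) (hT : IsTimes P ℱ ρ X) (hA : IsATA B α ℱ X a)
    {aStar b : Fin n → ℕ} (hstar : IsBestAllocation B (meanTime ρ) aStar)
    (hb : IsBestAllocation B (fun c => proxyLoss c μ) b) {d : ℝ} (hd : 0 < d)
    (hgap : ∀ i, ∀ j ≤ B, proxyLoss b μ < (j : ℝ) * μ i → proxyLoss b μ + d ≤ j * μ i)
    {K : ℕ} (hK : 2 ≤ K) :
    totalTime P X a K ≤ (1 + 4 * eta ν μ * Real.log B) * (K * meanTime ρ aStar) +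
      regretConst n B μ (min 1 (d / B / (8 * (α + 1)))) * Real.log K := by
  have hint : ∀ i, Integrable (fun y => y) (ν i) := fun i =>
    integrable_of_psi1Norm_sub_le hα (hpsi i)
  have hμ : ∀ i, 0 < μ i := fun i => hmean i ▸ integral_pos_of_ae_pos (hint i) (hpos i)
  have ha : ∀ k ω, a k ω ∈ allocations n B := fun k ω => (hA.argmin k ω).1
  have hne : ∀ c ∈ allocations n B, ∃ i, c i ≠ 0 := fun c hc =>
    exists_ne_zero_of_mem_allocations hB hc
  have hXm : Measurable (X 0) := (hT.measurable 0).mono (ℱ.le _) le_rfl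
  have : IsProbabilityMeasure ρ := by
    rw [← hT.law 0]
    exact Measure.isProbabilityMeasure_map hXm.aemeasurable
  have hfin : ∀ i, psi1Norm (ν i) (fun x => x - μ i) ≠ ∞ := fun i =>
    ((hpsi i).trans_lt ENNReal.ofReal_lt_top).ne
  set q := min 1 (d / B / (8 * (α + 1))) with hq
  set F := 1 + 4 * eta ν μ * Real.log B with hF
  set M := (B : ℝ) * ∑ i, μ i with hM
  have hlogB : 0 ≤ Real.log B := Real.log_natCast_nonneg B
  have hη0 : 0 ≤ eta ν μ := Real.iSup_nonneg fun i => by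
    have := hμ i
    positivity
  have hF0 : 0 ≤ F := by positivity
  have hproxy0 : 0 ≤ proxyLoss aStar μ := Real.iSup_nonneg fun i => by
    have := hμ i
    positivity
  have hjensen : proxyLoss aStar μ ≤ meanTime ρ aStar :=
    hρ.proxyLoss_le_meanTime hint hmean hμ (hne _ hstar.1)
  have hM0 : 0 ≤ M := mul_nonneg (Nat.cast_nonneg _) (Finset.sum_nonneg fun i _ => (hμ i).le)
  have hopt : ∀ c ∈ allocations n B, proxyLoss c μ ≤ proxyLoss b μ →
      meanTime ρ c ≤ F * meanTime ρ aStar := fun c hc hcl => by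
    calc _ ≤ F * proxyLoss c μ := hρ.meanTime_le hint hmean hμ hfin hB hc
      _ ≤ F * meanTime ρ aStar := by
          gcongr
          exact (hcl.trans (hb.2 _ hstar.1)).trans hjensen
  have hall : ∀ c ∈ allocations n B, meanTime ρ c ≤ M := fun c hc => by
    refine (hρ.meanTime_le_sum hint hmean hpos (hne c hc)).trans ?_
    rw [hM, Finset.mul_sum]
    exact Finset.sum_le_sum fun i _ => mul_le_mul_of_nonneg_right
      (by exact_mod_cast le_of_mem_allocations hc i) (hμ i).le
  have hpath := sum_meanTime_le hα hB hμ hA hb.1 rfl hd hgap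
    (mul_nonneg hF0 (hproxy0.trans hjensen)) hM0 hopt hall hK
  have hbadm : ∀ k, MeasurableSet (badEvent μ α X a k) := fun k =>
    measurableSet_badEvent hT.measurable hA.measurable k
  have hbadI : ∀ k, Integrable ((badEvent μ α X a k).indicator fun _ => (1 : ℝ)) P := fun k =>
    (integrable_const _).indicator (hbadm k)
  have hsumI : Integrable (fun ω => ∑ k ∈ Finset.range K,
      (badEvent μ α X a k).indicator (fun _ => (1 : ℝ)) ω) P :=
    integrable_finsetSum _ fun k _ => hbadI k
  have hsumI' : Integrable (fun ω => ∑ k ∈ Finset.range K,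
      (badEvent μ α X a k).indicator (fun _ => (1 : ℝ)) ω +
        n * (3 * Real.log K / q ^ 2 + 1)) P := hsumI.add (integrable_const _)
  have hbad : ∑ k ∈ Finset.range K, P.real (badEvent μ α X a k) ≤
      n * B * (1 + Real.log K) := by
    calc _ ≤ ∑ k ∈ Finset.range K, (n : ℝ) * B * (1 / ((k : ℝ) + 1)) :=
          Finset.sum_le_sum fun k _ => ENNReal.toReal_le_of_le_ofReal (by positivity)
            (measure_badEvent_le hν hρ hint hmean hα hpsi hT hA.measurable ha k)
      _ ≤ _ := by
          rw [← Finset.mul_sum]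
          gcongr
          exact sum_range_one_div_le K
  have hlog2 : 0 < Real.log 2 := Real.log_pos (by norm_num)
  have hlogK : 1 ≤ 1 / Real.log 2 * Real.log K := by
    rw [one_div_mul_eq_div, le_div_iff₀ hlog2, one_mul]
    exact Real.log_le_log (by norm_num) (by exact_mod_cast hK)
  calc totalTime P X a K
      = ∫ ω, ∑ k ∈ Finset.range K, meanTime ρ (a k ω) ∂P := by
        rw [integral_finsetSum _ fun k _ => integrable_meanTime hA.measurable ha k]
        exact Finset.sum_congr rfl fun k _ =>
          hT.integral_compTime hB hρ hint hA.measurable ha k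
    _ ≤ ∫ ω, K * (F * meanTime ρ aStar) +
          M * (∑ k ∈ Finset.range K, (badEvent μ α X a k).indicator (fun _ => (1 : ℝ)) ω +
            n * (3 * Real.log K / q ^ 2 + 1)) ∂P :=
        integral_mono
          (integrable_finsetSum _ fun k _ => integrable_meanTime hA.measurable ha k)
          ((integrable_const _).add (hsumI'.const_mul _)) hpath
    _ = K * (F * meanTime ρ aStar) +
          M * (∑ k ∈ Finset.range K, P.real (badEvent μ α X a k) +
            n * (3 * Real.log K / q ^ 2 + 1)) := by
        rw [integral_add (integrable_const _) (hsumI'.const_mul _),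
          integral_const_mul M, integral_add hsumI (integrable_const _),
          integral_finsetSum _ fun k _ => hbadI k]
        simp [integral_indicator_const, hbadm]
    _ ≤ K * (F * meanTime ρ aStar) +
          M * (n * B * (1 / Real.log 2 * Real.log K + Real.log K) +
            n * (3 * Real.log K / q ^ 2 + 1 / Real.log 2 * Real.log K)) := by
        gcongr
        refine hbad.trans ?_
        gcongr
    _ = _ := by
        rw [regretConst, ← hM]
        ring

end

end ATA

theorem theorem1 (n B : ℕ) (hn : 0 < n) (hB : 0 < B) (α : ℝ) (hα : 0 ≤ α) (μ : Fin n → ℝ) :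
    ∃ c : ℝ, ∀ (ν : Fin n → Measure ℝ) (_ : ∀ i, IsProbabilityMeasure (ν i))
      (_ : ∀ i, ∫ x, x ∂(ν i) = μ i)
      (_ : ∀ i, ∀ᵐ x ∂(ν i), 0 < x)
      (_ : ∀ i, ATA.psi1Norm (ν i) (fun x => x - μ i) ≤ ENNReal.ofReal α)
      (ρ : Measure (Fin n → ℕ → ℝ)) (_ : ATA.IsRoundLaw ν ρ)
      (Ω : Type*) (mΩ : MeasurableSpace Ω) (P : Measure Ω) (_ : IsProbabilityMeasure P)
      (ℱ : Filtration ℕ mΩ) (X : ℕ → Ω → Fin n → ℕ → ℝ) (_ : ATA.IsTimes P ℱ ρ X)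
      (a : ℕ → Ω → Fin n → ℕ) (_ : ATA.IsATA B α ℱ X a)
      (aStar : Fin n → ℕ) (_ : ATA.IsBestAllocation B (ATA.meanTime ρ) aStar),
      (∀ k, Integrable (fun ω => ATA.compTime (a k ω) (X k ω)) P) ∧
      ∀ K : ℕ, 2 ≤ K →
        ATA.totalTime P X a K ≤
          (1 + 4 * ATA.eta ν μ * Real.log B) * (K * ATA.meanTime ρ aStar) + c * Real.log K := by
  have hne : (Finset.piAntidiag (Finset.univ : Finset (Fin n)) B).Nonempty :=
    ⟨Pi.single ⟨0, hn⟩ B, Finset.mem_piAntidiag.2 ⟨by simp, by simp⟩⟩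
  obtain ⟨b, hb, hbmin⟩ := Finset.exists_min_image _ (fun c => ATA.proxyLoss c μ) hne
  have hbest : ATA.IsBestAllocation B (fun c => ATA.proxyLoss c μ) b :=
    ⟨(Finset.mem_piAntidiag.1 hb).1, fun c hc => hbmin c (Finset.mem_piAntidiag.2 ⟨hc, by simp⟩)⟩
  -- Only finitely many values `j * μ i` occur as coordinates of a proxy loss, which gives a gap.
  obtain ⟨d, hd, hgap⟩ := ATA.exists_pos_forall_add_le
    (Finset.image (fun p : Fin n × ℕ => (p.2 : ℝ) * μ p.1)
      (Finset.univ ×ˢ Finset.range (B + 1))) (ATA.proxyLoss b μ)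
  refine ⟨ATA.regretConst n B μ (min 1 (d / B / (8 * (α + 1)))), ?_⟩
  intro ν hν hmean hpos hpsi ρ hρ Ω mΩ P hP ℱ X hT a hA aStar hstar
  refine ⟨fun k => hT.integrable_compTime hB hρ
    (fun i => ATA.integrable_of_psi1Norm_sub_le hα (hpsi i)) hA.measurable
    (fun k ω => (hA.argmin k ω).1) k, fun K hK => ?_⟩
  refine ATA.totalTime_le hα hB hν hmean hpos hpsi hρ hT hA hstar hbest hd
    (fun i j hj => hgap _ (Finset.mem_image.2 ⟨(i, j), ?_, rfl⟩)) hK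
  simp only [Finset.mem_product, Finset.mem_univ, Finset.mem_range, true_and]
  omega
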